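/- For $r\ge 0$ and $i\in\{0,1,2,\dots\}$ let $\mathrm{poi}(r,i)=e^{-r}r^i/i!$ (with $0^0=1$). Let $k>0$ (the Poissonized sample size), let $y_j>0$ be one of the distinct positive probabilities of the hypothesis distribution $P$, and let $h_j>0$ be the number of domain elements that have probability $y_j$. For $\alpha<0$, $u\in(0,1)$ and $\kappa=(\kappa_i)_{i\ge 0}$ a real sequence, let $$F(\kappa)=u\,h_j\log\sum_{i\ge 0}e^{(1-u)\kappa_i}\,\mathrm{poi}(ky_j,i)+(1-u)\,h_j\sup_{x\ge 0}\Big(-\alpha|x-y_j|+\log\sum_{i\ge 0}e^{-u\kappa_i}\,\mathrm{poi}(kx,i)\Big)\in(-\infty,+\infty].$$ For nonnegative real weights $a=(a_x)_{x\ge 0}$ let $$D(a)=h_j\log\frac{\sum_i\big(\sum_x a_x\,\mathrm{poi}(kx,i)\big)^{1-u}\,\mathrm{poi}(ky_j,i)^u}{\big(\sum_x a_x e^{\alpha|x-y_j|}\big)^{1-u}},$$ with $D(a)=-\infty$ if $a=0$ or if the denominator is infinite. **Lemma.** Fix $k,y_j,h_j>0$, $\alpha<0$ and $u\in(0,1)$.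 There are a minimizer $\kappa_{\cdot,j}$ of $F$ over all real sequences (the minimum may be $+\infty$) and weights $a_x\ge 0$ $(x\ge 0)$ such that $$\kappa_{i,j}=\log\sum_x a_x\frac{\mathrm{poi}(kx,i)}{\mathrm{poi}(ky_j,i)}\qquad\text{for all } i\ge 0,$$ and exactly two of the weights $a_x$ are nonzero, at points $0\le x_{1,j}<y_j<x_{2,j}$; the weights are normalized so that $a_{x_{1,j}}=q_j$ and $a_{x_{2,j}}=1-q_j$ for some $q_j\in(0,1)$. These are the only nonnegative weights that express this $\kappa_{\cdot,j}$ in this form. In particular, $\kappa_{\cdot,j}$ is the logarithm of a sum of two exponentials in $i$, $$\kappa_{i,j}=\log\Big(q_j\,e^{k(y_j-x_{1,j})}\big(x_{1,j}/y_j\big)^i+(1-q_j)\,e^{k(y_j-x_{2,j})}\big(x_{2,j}/y_j\big)^i\Big),$$ and if $x_{1,j}>0$ it is a shifted log cosh plus a linear term: $\kappa_{i,j}=A+Bi+\log\cosh(C(i-s))$ for all $i$, for some real $A,B,s$ and $C>0$. Moreover, if $-k<\alpha$, then $F(\kappa_{\cdot,j})$ is finite, $a$ maximizes $D$ over all families of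 nonnegative weights, and $F(\kappa_{\cdot,j})=D(a)$; so the hardest alternative splits the hypothesis probability $y_j$ into the two masses $x_{1,j}$ and $x_{2,j}$. -/

import Mathlib

open scoped NNReal ENNReal

noncomputable section

namespace TwoPoint

/-- `poi r i` is the Poisson probability `e^{-r} r^i / i!`. -/
def poi (r : ℝ≥0) (i : ℕ) : ℝ≥0∞ :=
  ProbabilityTheory.poissonMeasure r {i}

/-- The function of `κ` in the inner minimization, for one class of `h` domain elements that have
hypothesis probability `y` each, with `Poi k` samples:
`u h log ∑ᵢ e^{(1-u)κᵢ} poi(ky,i) + (1-u) h sup_{x ≥ 0} (-α|x-y| + log ∑ᵢ e^{-uκᵢ} poi(kx,i))`.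
Both summands are `> -∞`, and each may be `+∞`. -/
def innerObjective (k y : ℝ≥0) (h α u : ℝ) (κ : ℕ → ℝ) : EReal :=
  ((u * h : ℝ) : EReal) *
      ENNReal.log (∑' i, ENNReal.ofReal (Real.exp ((1 - u) * κ i)) * poi (k * y) i) +
    (((1 - u) * h : ℝ) : EReal) *
      ⨆ x : ℝ≥0, (((-α * |(x : ℝ) - y| : ℝ) : EReal) +
        ENNReal.log (∑' i, ENNReal.ofReal (Real.exp (-u * κ i)) * poi (k * x) i))

/-- `κᵢ = log ∑ₓ aₓ poi(kx,i) / poi(ky,i)` for all `i`. As the left side is a real number, the sum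
is required to be positive and finite. -/
def HasClosedForm (k y : ℝ≥0) (a : ℝ≥0 → ℝ≥0) (κ : ℕ → ℝ) : Prop :=
  ∀ i, (κ i : EReal) =
    ENNReal.log (∑' x : ℝ≥0, (a x : ℝ≥0∞) * (poi (k * x) i / poi (k * y) i))

/-- The function of the weights `a` in the dual maximization (the choice of the hardest
alternative):
`h log ((∑ᵢ (∑ₓ aₓ poi(kx,i))^{1-u} poi(ky,i)^u) / (∑ₓ aₓ e^{α|x-y|})^{1-u})`.
It is `-∞` if `a = 0` or if the denominator is infinite. -/
def dualObjective (k y : ℝ≥0) (h α u : ℝ) (a : ℝ≥0 → ℝ≥0) : EReal :=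
  (h : EReal) * ENNReal.log
    ((∑' i, (∑' x : ℝ≥0, (a x : ℝ≥0∞) * poi (k * x) i) ^ (1 - u) * poi (k * y) i ^ u) /
      (∑' x : ℝ≥0, (a x : ℝ≥0∞) * ENNReal.ofReal (Real.exp (α * |(x : ℝ) - y|))) ^ (1 - u))

end TwoPoint

end

namespace TwoPoint

open Set Filter Topology

/-! The two-point form comes from solving the dual problem among two-point alternatives and showing
that the solution certifies itself against all competitors. Weak duality
(`dualObjective_le_innerObjective`) is Hölder's inequality. It remains to find, for `-k < α`, a
mixture for which the gap closes. For `α ≤ -k` the primal is identically infinite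
(`innerObjective_eq_top`) and any two-point mixture serves.

Rescale by `τ = ky`, `z = kx`, `b = -α/k`, so that `0 < b < 1`, and give the two points `s ≤ τ ≤ t`
the costs `1 - w` and `w`, which normalizes the dual denominator to 1. The numerator is then
`affinity`. It attains its maximum over `configs`: as `b < 1`, mass far to the right is worthless,
and some point to the right of `τ` beats every point to the left, so `w` cannot degenerate to 0
(`exists_isMaxOn_affinity`).

Up to the factor `1 - u`, `gain` at `z` is the derivative of the affinity in the direction of a unit
of cost at `z`. Optimality only compares `s` and `t` with nearby points on their own sides, but the
gain is log-concave on each side of `τ`: the mixture is a sum of two geometric sequences, hence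
log-convex, its power `-u` is log-concave, and generating functions preserve this
(`concaveOn_log_egf`). So local comparisons become global and the gain is at most the affinity
everywhere (`gain_le_affinity`). That bounds the supremum in the primal, at the logarithm of the
mixture, by the dual value. The kink of `e^{b|z-τ|}` keeps both points away from `τ`
(`gain_ne_affinity`). Uniqueness of the weights is a moment argument (`eq_pairWeight`). -/

/-! ### Generating functions of log-concave sequences -/

/-- The exponential generating function `∑ᵢ Wᵢ tⁱ / i!` of a sequence. -/
noncomputable def egf (W : ℕ → ℝ) (t : ℝ) : ℝ := ∑' i : ℕ, W i * (t ^ i / (i.factorial : ℝ))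

theorem summable_egf {W : ℕ → ℝ} {C : ℝ} (hW : ∀ i, |W i| ≤ C) (t : ℝ) :
    Summable fun i : ℕ => W i * (t ^ i / (i.factorial : ℝ)) := by
  refine Summable.of_norm_bounded ((Real.summable_pow_div_factorial |t|).mul_left C) fun i => ?_
  rw [norm_mul, norm_div, norm_pow, Real.norm_eq_abs, Real.norm_eq_abs, Real.norm_natCast]
  exact mul_le_mul_of_nonneg_right (hW i) (by positivity)

theorem hasDerivAt_egf {W : ℕ → ℝ} {C : ℝ} (hW : ∀ i, |W i| ≤ C) (t : ℝ) :
    HasDerivAt (egf W) (egf (fun i => W (i + 1)) t) t := by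
  have hC : 0 ≤ C := (abs_nonneg _).trans (hW 0)
  set R : ℝ := |t| + 1
  have hR : 0 < R := by positivity
  have key := hasDerivAt_tsum_of_isPreconnected (𝕜 := ℝ) (F := ℝ)
    (u := fun i : ℕ => C * (i * R ^ (i - 1) / (i.factorial : ℝ)))
    (g := fun (i : ℕ) (t : ℝ) => W i * (t ^ i / (i.factorial : ℝ)))
    (g' := fun (i : ℕ) (t : ℝ) => W i * (i * t ^ (i - 1) / (i.factorial : ℝ)))
    (t := Metric.ball 0 R) (y₀ := 0) (y := t) ?_ Metric.isOpen_ball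
    (convex_ball 0 R).isPreconnected ?_ ?_ (by simpa using hR) (summable_egf hW 0) (by simp [R])
  · have hsum : ∑' i : ℕ, W i * (i * t ^ (i - 1) / (i.factorial : ℝ)) =
        egf (fun i => W (i + 1)) t := by
      have h0 : Summable fun i : ℕ => W i * (i * t ^ (i - 1) / (i.factorial : ℝ)) := by
        rw [← summable_nat_add_iff 1]
        refine (summable_egf (fun i => hW (i + 1)) t).congr fun i => ?_
        rw [Nat.factorial_succ]; push_cast; field_simp
      rw [h0.tsum_eq_zero_add, egf]
      simp only [Nat.cast_zero, zero_mul, zero_div, mul_zero, zero_add]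
      refine tsum_congr fun i => ?_
      rw [Nat.factorial_succ]; push_cast; field_simp
    rw [← hsum]; exact key
  · rw [← summable_nat_add_iff 1]
    refine ((Real.summable_pow_div_factorial R).mul_left C).congr fun i => ?_
    rw [Nat.factorial_succ]; push_cast; field_simp
  · intro i x _
    exact ((hasDerivAt_pow i x).div_const _).const_mul _
  · intro i x hx
    have hx' : |x| ≤ R := by simpa using (mem_ball_zero_iff.1 hx).le
    rw [norm_mul, norm_div, norm_mul, norm_pow, Real.norm_natCast, Real.norm_natCast,
      Real.norm_eq_abs, Real.norm_eq_abs]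
    gcongr
    exact hW i

theorem egf_pos {W : ℕ → ℝ} {C : ℝ} (hW : ∀ i, |W i| ≤ C) (hpos : ∀ i, 0 < W i) {t : ℝ}
    (ht : 0 ≤ t) : 0 < egf W t := by
  refine (summable_egf hW t).tsum_pos (fun i => ?_) 0 ?_
  · have := hpos i; positivity
  · simpa using hpos 0

/-- Each product of sums is half a double sum symmetrized under exchange of the indices, so the
symmetrized terms may be compared one by one. -/
theorem tsum_mul_tsum_le_of_symm {a b c d : ℕ → ℝ} (ha : Summable a) (hb : Summable b)
    (hc : Summable c) (hd : Summable d)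
    (h : ∀ i j, a i * b j + a j * b i ≤ c i * d j + c j * d i) :
    (∑' i, a i) * ∑' i, b i ≤ (∑' i, c i) * ∑' i, d i := by
  have key : ∀ f g : ℕ → ℝ, Summable f → Summable g →
      Summable (fun z : ℕ × ℕ => f z.1 * g z.2 + f z.2 * g z.1) ∧
      ∑' z : ℕ × ℕ, (f z.1 * g z.2 + f z.2 * g z.1) = 2 * ((∑' i, f i) * ∑' i, g i) := by
    intro f g hf hg
    have s1 : Summable fun z : ℕ × ℕ => f z.1 * g z.2 :=
      summable_mul_of_summable_norm hf.norm hg.norm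
    have s2 : Summable fun z : ℕ × ℕ => f z.2 * g z.1 := (Equiv.prodComm ℕ ℕ).summable_iff.2 s1
    have e2 : ∑' z : ℕ × ℕ, f z.2 * g z.1 = ∑' z : ℕ × ℕ, f z.1 * g z.2 :=
      (Equiv.prodComm ℕ ℕ).tsum_eq fun z : ℕ × ℕ => f z.1 * g z.2
    refine ⟨s1.add s2, ?_⟩
    rw [s1.tsum_add s2, e2, hf.tsum_mul_tsum hg s1]
    ring
  obtain ⟨s1, e1⟩ := key a b ha hb
  obtain ⟨s2, e2⟩ := key c d hc hd
  have := Summable.tsum_le_tsum (fun z : ℕ × ℕ => h z.1 z.2) s1 s2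
  rw [e1, e2] at this
  linarith

/-- If `W` is log-concave then the logarithmic derivative of its generating function is
decreasing, by symmetrization of a double sum. -/
theorem egf_succ_mul_le {W : ℕ → ℝ} {C : ℝ} (hW : ∀ i, |W i| ≤ C)
    (hlc : ∀ i j, i ≤ j → W (j + 1) * W i ≤ W (i + 1) * W j) {s t : ℝ} (hs : 0 ≤ s)
    (hst : s ≤ t) :
    egf (fun i => W (i + 1)) t * egf W s ≤ egf (fun i => W (i + 1)) s * egf W t := by
  have hW' : ∀ i, |W (i + 1)| ≤ C := fun i => hW (i + 1)
  have hpow : ∀ i j : ℕ, i ≤ j → t ^ i * s ^ j ≤ s ^ i * t ^ j := by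
    intro i j hij
    obtain ⟨d, rfl⟩ := Nat.exists_eq_add_of_le hij
    have : s ^ d ≤ t ^ d := pow_le_pow_left₀ hs hst d
    have h2 : 0 ≤ s ^ i * t ^ i := mul_nonneg (pow_nonneg hs _) (pow_nonneg (hs.trans hst) _)
    rw [pow_add, pow_add]
    nlinarith [mul_le_mul_of_nonneg_left this h2]
  refine tsum_mul_tsum_le_of_symm (summable_egf hW' t) (summable_egf hW s) (summable_egf hW' s)
    (summable_egf hW t) fun i j => ?_
  -- Both factors change sign together with the order of `i` and `j`, in opposite directions.
  have aux : (W (i + 1) * W j - W (j + 1) * W i) * (t ^ i * s ^ j - s ^ i * t ^ j) ≤ 0 := by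
    rcases le_total i j with hij | hij
    · exact mul_nonpos_of_nonneg_of_nonpos (sub_nonneg.2 (hlc i j hij))
        (sub_nonpos.2 (hpow i j hij))
    · refine mul_nonpos_of_nonpos_of_nonneg (sub_nonpos.2 (hlc j i hij)) (sub_nonneg.2 ?_)
      have := hpow j i hij
      linarith
  have hfac : 0 ≤ ((i.factorial : ℝ) * (j.factorial : ℝ))⁻¹ := by positivity
  have := mul_nonpos_of_nonpos_of_nonneg aux hfac
  rw [← sub_nonpos]
  refine le_of_eq_of_le ?_ this
  rw [mul_inv]
  simp only [div_eq_mul_inv]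
  ring

theorem concaveOn_log_egf {W : ℕ → ℝ} {C : ℝ} (hW : ∀ i, |W i| ≤ C) (hpos : ∀ i, 0 < W i)
    (hlc : ∀ i j, i ≤ j → W (j + 1) * W i ≤ W (i + 1) * W j) :
    ConcaveOn ℝ (Ici 0) fun t => Real.log (egf W t) := by
  have hd : ∀ t : ℝ, 0 ≤ t → HasDerivAt (fun t => Real.log (egf W t))
      (egf (fun i => W (i + 1)) t / egf W t) t := fun t ht =>
    (hasDerivAt_egf hW t).log (egf_pos hW hpos ht).ne'
  refine AntitoneOn.concaveOn_of_deriv (convex_Ici 0)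
    (fun t ht => (hd t ht).continuousAt.continuousWithinAt)
    (fun t ht => (hd t (interior_subset ht)).differentiableAt.differentiableWithinAt) ?_
  intro s hs t ht hst
  have hs' : 0 ≤ s := interior_subset hs
  have ht' : 0 ≤ t := interior_subset ht
  rw [(hd s hs').deriv, (hd t ht').deriv, div_le_div_iff₀ (egf_pos hW hpos ht')
    (egf_pos hW hpos hs')]
  exact egf_succ_mul_le hW hlc hs' hst

/-! ### The rescaled problem: mixtures, affinity and gain -/

/-- The real Poisson probability `e^{-τ} τ^i / i!`. -/
noncomputable def poiReal (τ : ℝ) (i : ℕ) : ℝ := Real.exp (-τ) * (τ ^ i / (i.factorial : ℝ))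

/-- The likelihood ratio of `Poi x` to `Poi τ`. -/
noncomputable def likeRatio (τ x : ℝ) (i : ℕ) : ℝ := Real.exp (τ - x) * (x / τ) ^ i

/-- The inverse `e^{b|x-τ|}` of the cost of a unit mass at `x`. -/
noncomputable def tilt (b τ x : ℝ) : ℝ := Real.exp (b * |x - τ|)

/-- The likelihood ratio of the mixture of `Poi s` and `Poi t` whose costs are `1 - w` and `w`,
where `c = (w, s, t)`. -/
noncomputable def mix (b τ : ℝ) (c : ℝ × ℝ × ℝ) (i : ℕ) : ℝ :=
  (1 - c.1) * (tilt b τ c.2.1 * likeRatio τ c.2.1 i) + c.1 * (tilt b τ c.2.2 * likeRatio τ c.2.2 i)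

/-- The Hellinger-type affinity between the mixture `c` and `Poi τ`. -/
noncomputable def affinity (u b τ : ℝ) (c : ℝ × ℝ × ℝ) : ℝ :=
  ∑' i, mix b τ c i ^ (1 - u) * poiReal τ i

/-- The derivative weights of the affinity. -/
noncomputable def wt (u b τ : ℝ) (c : ℝ × ℝ × ℝ) (i : ℕ) : ℝ := mix b τ c i ^ (-u)

/-- The function whose supremum enters the primal objective. -/
noncomputable def gain (b τ : ℝ) (W : ℕ → ℝ) (z : ℝ) : ℝ :=
  tilt b τ z * (Real.exp (-z) * egf W z)

/-- The triples `(w, s, t)` with `0 < w ≤ 1` and `0 ≤ s ≤ τ ≤ t`. -/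
def configs (τ : ℝ) : Set (ℝ × ℝ × ℝ) :=
  {c | 0 < c.1 ∧ c.1 ≤ 1 ∧ 0 ≤ c.2.1 ∧ c.2.1 ≤ τ ∧ τ ≤ c.2.2}

theorem poiReal_pos {τ : ℝ} (hτ : 0 < τ) (i : ℕ) : 0 < poiReal τ i := by
  unfold poiReal; positivity

theorem tilt_pos (b τ x : ℝ) : 0 < tilt b τ x := Real.exp_pos _

theorem one_le_tilt {b : ℝ} (hb : 0 < b) (τ x : ℝ) : 1 ≤ tilt b τ x :=
  Real.one_le_exp (by positivity)

theorem likeRatio_nonneg {τ x : ℝ} (hτ : 0 < τ) (hx : 0 ≤ x) (i : ℕ) : 0 ≤ likeRatio τ x i := by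
  unfold likeRatio; positivity

theorem likeRatio_mul_poiReal {τ : ℝ} (hτ : 0 < τ) (x : ℝ) (i : ℕ) :
    likeRatio τ x i * poiReal τ i = Real.exp (-x) * (x ^ i / (i.factorial : ℝ)) := by
  unfold likeRatio poiReal
  rw [div_pow, show -x = (τ - x) + -τ by ring, Real.exp_add]
  field_simp

theorem exp_le_likeRatio {τ x : ℝ} (hτ : 0 < τ) (hx : τ ≤ x) (i : ℕ) :
    Real.exp (τ - x) ≤ likeRatio τ x i :=
  le_mul_of_one_le_right (Real.exp_pos _).le (one_le_pow₀ ((one_le_div hτ).2 hx))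

/-- For a point beyond `τ` the likelihood ratio is smallest at `i = 0`. This bound, uniform in `i`,
makes the weights `wt` bounded; it is why `configs` demands positive weight on the right point. -/
theorem mix_lower {b τ : ℝ} (hb : 0 < b) (hτ : 0 < τ) {c : ℝ × ℝ × ℝ} (hc : c ∈ configs τ)
    (i : ℕ) : c.1 * Real.exp (τ - c.2.2) ≤ mix b τ c i := by
  obtain ⟨h1, h2, h3, h4, h5⟩ := hc
  have a1 : 0 ≤ (1 - c.1) * (tilt b τ c.2.1 * likeRatio τ c.2.1 i) :=
    mul_nonneg (by linarith) (mul_nonneg (tilt_pos _ _ _).le (likeRatio_nonneg hτ h3 i))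
  have a2 : Real.exp (τ - c.2.2) ≤ tilt b τ c.2.2 * likeRatio τ c.2.2 i :=
    (exp_le_likeRatio hτ h5 i).trans
      (le_mul_of_one_le_left (likeRatio_nonneg hτ (hτ.le.trans h5) i) (one_le_tilt hb _ _))
  unfold mix
  have := mul_le_mul_of_nonneg_left a2 h1.le
  linarith

theorem mix_pos {b τ : ℝ} (hb : 0 < b) (hτ : 0 < τ) {c : ℝ × ℝ × ℝ} (hc : c ∈ configs τ)
    (i : ℕ) : 0 < mix b τ c i :=
  (mul_pos hc.1 (Real.exp_pos _)).trans_le (mix_lower hb hτ hc i)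

theorem wt_pos {u b τ : ℝ} (hb : 0 < b) (hτ : 0 < τ) {c : ℝ × ℝ × ℝ} (hc : c ∈ configs τ)
    (i : ℕ) : 0 < wt u b τ c i :=
  Real.rpow_pos_of_pos (mix_pos hb hτ hc i) _

theorem abs_wt_le {u b τ : ℝ} (hu : 0 < u) (hb : 0 < b) (hτ : 0 < τ) {c : ℝ × ℝ × ℝ}
    (hc : c ∈ configs τ) {δ : ℝ} (hδ : 0 < δ) (h : δ ≤ c.1 * Real.exp (τ - c.2.2)) (i : ℕ) :
    |wt u b τ c i| ≤ δ ^ (-u) := by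
  rw [abs_of_pos (wt_pos hb hτ hc i)]
  exact Real.rpow_le_rpow_of_nonpos hδ (h.trans (mix_lower hb hτ hc i)) (by linarith)

theorem exists_abs_wt_le {u b τ : ℝ} (hu : 0 < u) (hb : 0 < b) (hτ : 0 < τ) {c : ℝ × ℝ × ℝ}
    (hc : c ∈ configs τ) : ∃ C, ∀ i, |wt u b τ c i| ≤ C :=
  ⟨_, abs_wt_le hu hb hτ hc (mul_pos hc.1 (Real.exp_pos _)) le_rfl⟩

theorem hasSum_gain {b τ : ℝ} (hτ : 0 < τ) {W : ℕ → ℝ} {C : ℝ} (hW : ∀ i, |W i| ≤ C) (z : ℝ) :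
    HasSum (fun i => W i * ((tilt b τ z * likeRatio τ z i) * poiReal τ i)) (gain b τ W z) := by
  have := ((summable_egf hW z).hasSum.mul_left (Real.exp (-z))).mul_left (tilt b τ z)
  refine (this.congr_fun ?_) 
  intro i
  rw [mul_assoc, likeRatio_mul_poiReal hτ]
  ring

theorem hasSum_wt_mul_mix {b τ : ℝ} (hτ : 0 < τ) {W : ℕ → ℝ} {C : ℝ} (hW : ∀ i, |W i| ≤ C)
    (c : ℝ × ℝ × ℝ) :
    HasSum (fun i => W i * (mix b τ c i * poiReal τ i))
      ((1 - c.1) * gain b τ W c.2.1 + c.1 * gain b τ W c.2.2) := by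
  have := ((hasSum_gain (b := b) hτ hW c.2.1).mul_left (1 - c.1)).add
    ((hasSum_gain (b := b) hτ hW c.2.2).mul_left c.1)
  refine this.congr_fun ?_
  intro i
  unfold mix
  ring

theorem wt_mul_mix {u b τ : ℝ} (hb : 0 < b) (hτ : 0 < τ) {c : ℝ × ℝ × ℝ} (hc : c ∈ configs τ)
    (i : ℕ) : wt u b τ c i * mix b τ c i = mix b τ c i ^ (1 - u) := by
  have := mix_pos hb hτ hc i
  rw [wt, show 1 - u = -u + 1 by ring, Real.rpow_add_one this.ne']

theorem hasSum_affinity {u b τ : ℝ} (hu : 0 < u) (hb : 0 < b) (hτ : 0 < τ) {c : ℝ × ℝ × ℝ}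
    (hc : c ∈ configs τ) :
    HasSum (fun i => mix b τ c i ^ (1 - u) * poiReal τ i) (affinity u b τ c) ∧
    affinity u b τ c = (1 - c.1) * gain b τ (wt u b τ c) c.2.1 +
      c.1 * gain b τ (wt u b τ c) c.2.2 := by
  obtain ⟨C, hC⟩ := exists_abs_wt_le (u := u) hu hb hτ hc
  have h := hasSum_wt_mul_mix (b := b) hτ hC c
  simp only [← mul_assoc, wt_mul_mix hb hτ hc] at h
  exact ⟨h.summable.hasSum, h.tsum_eq⟩

/-! ### First-order comparison and regularity of the weights -/

/-- First-order comparison, by the concavity of `x ↦ x ^ (1 - u)`. -/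
theorem gain_comparison {u b τ : ℝ} (hu : 0 < u) (hu1 : u < 1) (hb : 0 < b) (hτ : 0 < τ)
    {c c' : ℝ × ℝ × ℝ} (hc : c ∈ configs τ) (hc' : c' ∈ configs τ)
    (hle : affinity u b τ c' ≤ affinity u b τ c) :
    (1 - c'.1) * gain b τ (wt u b τ c') c'.2.1 + c'.1 * gain b τ (wt u b τ c') c'.2.2 ≤
    (1 - c.1) * gain b τ (wt u b τ c') c.2.1 + c.1 * gain b τ (wt u b τ c') c.2.2 := by
  obtain ⟨C, hC⟩ := exists_abs_wt_le (u := u) hu hb hτ hc'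
  have h := hasSum_wt_mul_mix (b := b) hτ hC c
  obtain ⟨h1, h1'⟩ := hasSum_affinity (u := u) hu hb hτ hc'
  have h2 := (hasSum_affinity (u := u) hu hb hτ hc).1
  -- Weighted AM-GM, multiplied by the weights of `c'` and summed, bounds the affinity of `c` by `1
  -- - u` times the linear functional of `c'` at `c` plus `u` times the affinity of `c'`.
  have key := hasSum_le (fun i => ?_) h2 ((h.mul_left (1 - u)).add (h1.mul_left u))
  · rw [← h1']
    have : (1 - u) * affinity u b τ c' ≤ (1 - u) *
      ((1 - c.1) * gain b τ (wt u b τ c') c.2.1 + c.1 * gain b τ (wt u b τ c') c.2.2) := by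
      linarith
    exact le_of_mul_le_mul_left this (by linarith)
  · have m := mix_pos hb hτ hc i
    have m' := mix_pos hb hτ hc' i
    have e := wt_mul_mix (u := u) hb hτ hc' i
    have amgm := Real.geom_mean_le_arith_mean2_weighted (by linarith : 0 ≤ 1 - u) hu.le m.le m'.le
      (by ring)
    have p := poiReal_pos hτ i
    have w' := wt_pos (u := u) hb hτ hc' i
    have one : mix b τ c' i ^ u * wt u b τ c' i = 1 := by
      rw [wt, ← Real.rpow_add m']; simp
    have := mul_le_mul_of_nonneg_left amgm (mul_nonneg w'.le p.le)
    calc mix b τ c i ^ (1 - u) * poiReal τ i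
        = wt u b τ c' i * poiReal τ i * (mix b τ c i ^ (1 - u) * mix b τ c' i ^ u) := by
          linear_combination (-(mix b τ c i ^ (1 - u) * poiReal τ i)) * one
      _ ≤ _ := this
      _ = _ := by rw [← e]; ring

theorem wt_logConcave {u b τ : ℝ} (hu : 0 < u) (hb : 0 < b) (hτ : 0 < τ) {c : ℝ × ℝ × ℝ}
    (hc : c ∈ configs τ) (i j : ℕ) (hij : i ≤ j) :
    wt u b τ c (j + 1) * wt u b τ c i ≤ wt u b τ c (i + 1) * wt u b τ c j := by
  have m := mix_pos hb hτ hc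
  unfold wt
  rw [← Real.mul_rpow (m _).le (m _).le, ← Real.mul_rpow (m _).le (m _).le]
  refine Real.rpow_le_rpow_of_nonpos (mul_pos (m _) (m _)) ?_ (by linarith)
  obtain ⟨h1, h2, h3, h4, h5⟩ := hc
  obtain ⟨d, rfl⟩ := Nat.exists_eq_add_of_le hij
  set A := (1 - c.1) * (tilt b τ c.2.1 * Real.exp (τ - c.2.1)) with hA
  set B := c.1 * (tilt b τ c.2.2 * Real.exp (τ - c.2.2)) with hB
  set r := c.2.1 / τ
  set R := c.2.2 / τ
  have hr : 0 ≤ r := div_nonneg h3 hτ.le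
  have hrR : r ≤ R := div_le_div_of_nonneg_right (h4.trans h5) hτ.le
  have e : ∀ n, mix b τ c n = A * r ^ n + B * R ^ n := fun n => by
    simp only [mix, likeRatio, hA, hB]; ring
  have hA0 : 0 ≤ A := mul_nonneg (by linarith) (mul_pos (tilt_pos _ _ _) (Real.exp_pos _)).le
  have hB0 : 0 ≤ B := (mul_pos h1 (mul_pos (tilt_pos _ _ _) (Real.exp_pos _))).le
  have hR : 0 ≤ R := hr.trans hrR
  have hd : r ^ d ≤ R ^ d := pow_le_pow_left₀ hr hrR d
  -- This is the cross difference of the log-convex sequence `A rⁿ + B Rⁿ`; the negative exponent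
  -- has already reversed the inequality.
  have : 0 ≤ A * B * (r ^ i * R ^ i) * ((R - r) * (R ^ d - r ^ d)) :=
    mul_nonneg (by positivity) (mul_nonneg (sub_nonneg.2 hrR) (sub_nonneg.2 hd))
  rw [e, e, e, e, ← sub_nonneg]
  refine this.trans_eq ?_
  ring

theorem continuousOn_egf_wt {u b τ : ℝ} (hu : 0 < u) (hb : 0 < b) (hτ : 0 < τ) (w₀ T z : ℝ)
    (hw₀ : 0 < w₀) :
    ContinuousOn (fun c => egf (wt u b τ c) z) (configs τ ∩ {c | w₀ ≤ c.1 ∧ c.2.2 ≤ T}) := by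
  unfold egf
  refine continuousOn_tsum (u := fun i : ℕ =>
    (w₀ * Real.exp (τ - T)) ^ (-u) * (|z| ^ i / (i.factorial : ℝ))) (fun i => ?_)
    ((Real.summable_pow_div_factorial |z|).mul_left _) fun i c hc => ?_
  · refine ContinuousOn.mul (ContinuousOn.rpow_const ?_ fun c hc =>
      Or.inl (mix_pos hb hτ hc.1 i).ne') continuousOn_const
    unfold mix tilt likeRatio
    fun_prop
  · rw [norm_mul, norm_div, norm_pow, Real.norm_eq_abs, Real.norm_eq_abs, Real.norm_natCast]
    refine mul_le_mul_of_nonneg_right (abs_wt_le hu hb hτ hc.1 (by positivity) ?_ i)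
      (by positivity)
    have h2 : w₀ ≤ c.1 := hc.2.1
    have h3 : c.2.2 ≤ T := hc.2.2
    have h4 : 0 ≤ c.1 := hw₀.le.trans h2
    gcongr

/-! ### Existence of a maximizer -/

/-- The affinity of the one-point alternative at `x`. -/
noncomputable def pointAffinity (u b τ x : ℝ) : ℝ :=
  Real.exp ((1 - u) * (b * |x - τ|) + (1 - u) * (τ - x) - τ + τ * (x / τ) ^ (1 - u))

theorem hasSum_pointAffinity {u b τ x : ℝ} (hτ : 0 < τ) (hx : 0 ≤ x) :
    HasSum (fun i => (tilt b τ x * likeRatio τ x i) ^ (1 - u) * poiReal τ i)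
      (pointAffinity u b τ x) := by
  have h := NormedSpace.expSeries_div_hasSum_exp (𝔸 := ℝ) (τ * (x / τ) ^ (1 - u))
  have h2 := h.mul_left (Real.exp ((1 - u) * (b * |x - τ|) + (1 - u) * (τ - x) - τ))
  rw [← Real.exp_eq_exp_ℝ, ← Real.exp_add] at h2
  refine h2.congr_fun fun i => ?_
  have hr : 0 ≤ x / τ := by positivity
  rw [tilt, likeRatio, poiReal, ← mul_assoc (Real.exp (b * _)), ← Real.exp_add,
    Real.mul_rpow (Real.exp_pos _).le (by positivity), ← Real.exp_mul,
    ← Real.rpow_natCast, ← Real.rpow_mul hr, mul_comm (i : ℝ), Real.rpow_mul hr, Real.rpow_natCast,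
    mul_pow τ, sub_eq_add_neg (_ + _) τ, Real.exp_add _ (-τ), ← mul_add (1 - u),
    mul_comm (_ + _) (1 - u)]
  ring

theorem affinity_one (u b τ s t : ℝ) (hτ : 0 < τ) (ht : 0 ≤ t) :
    affinity u b τ (1, s, t) = pointAffinity u b τ t := by
  rw [← (hasSum_pointAffinity hτ ht).tsum_eq]
  simp [affinity, mix]

theorem affinity_zero (u b τ s t : ℝ) (hτ : 0 < τ) (hs : 0 ≤ s) :
    affinity u b τ (0, s, t) = pointAffinity u b τ s := by
  rw [← (hasSum_pointAffinity hτ hs).tsum_eq]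
  simp [affinity, mix]

/-- Subadditivity of `x ↦ x ^ (1 - u)`. It reduces the behaviour at infinity to that of one-point
alternatives. -/
theorem affinity_le {u b τ : ℝ} (hu : 0 < u) (hu1 : u < 1) (hτ : 0 < τ) {c : ℝ × ℝ × ℝ}
    (h0 : 0 ≤ c.1) (h1 : c.1 ≤ 1) (hs : 0 ≤ c.2.1) (ht : 0 ≤ c.2.2) :
    affinity u b τ c ≤ pointAffinity u b τ c.2.1 + pointAffinity u b τ c.2.2 := by
  have hh := (hasSum_pointAffinity (u := u) (b := b) hτ hs).add
    (hasSum_pointAffinity (u := u) (b := b) hτ ht)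
  have hA : ∀ x i, 0 ≤ x → 0 ≤ tilt b τ x * likeRatio τ x i := fun x i hx =>
    mul_nonneg (tilt_pos _ _ _).le (likeRatio_nonneg hτ hx i)
  have hle : ∀ i, mix b τ c i ^ (1 - u) * poiReal τ i ≤
      (tilt b τ c.2.1 * likeRatio τ c.2.1 i) ^ (1 - u) * poiReal τ i +
      (tilt b τ c.2.2 * likeRatio τ c.2.2 i) ^ (1 - u) * poiReal τ i := fun i => by
    rw [← add_mul]
    refine mul_le_mul_of_nonneg_right ?_ (poiReal_pos hτ i).le
    have a1 := hA _ i hs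
    have a2 := hA _ i ht
    have m1 : mix b τ c i ≤ tilt b τ c.2.1 * likeRatio τ c.2.1 i +
        tilt b τ c.2.2 * likeRatio τ c.2.2 i :=
      add_le_add (mul_le_of_le_one_left a1 (by linarith)) (mul_le_of_le_one_left a2 h1)
    have m0 : 0 ≤ mix b τ c i :=
      add_nonneg (mul_nonneg (by linarith) a1) (mul_nonneg h0 a2)
    exact (Real.rpow_le_rpow m0 m1 (by linarith)).trans
      (Real.rpow_add_le_add_rpow a1 a2 (by linarith) (by linarith))
  have hnn : ∀ i, 0 ≤ mix b τ c i ^ (1 - u) * poiReal τ i := fun i =>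
    mul_nonneg (Real.rpow_nonneg (add_nonneg (mul_nonneg (by linarith) (hA _ i hs))
      (mul_nonneg h0 (hA _ i ht))) _) (poiReal_pos hτ i).le
  exact hasSum_le hle (Summable.of_nonneg_of_le hnn hle hh.summable).hasSum hh

theorem continuousOn_affinity {u b τ : ℝ} (hu : 0 < u) (hu1 : u < 1) (hb : 0 < b) (hτ : 0 < τ)
    (R : ℝ) (hR : τ ≤ R) :
    ContinuousOn (affinity u b τ) (Icc 0 1 ×ˢ Icc 0 τ ×ˢ Icc τ R) := by
  have hA : ∀ x i, 0 ≤ x → 0 ≤ tilt b τ x * likeRatio τ x i := fun x i hx =>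
    mul_nonneg (tilt_pos _ _ _).le (likeRatio_nonneg hτ hx i)
  unfold affinity
  refine continuousOn_tsum (u := fun i : ℕ => τ ^ i / (i.factorial : ℝ) +
    2 * (Real.exp (b * R) * (R ^ i / (i.factorial : ℝ)))) (fun i => ?_)
    ((Real.summable_pow_div_factorial τ).add
      (((Real.summable_pow_div_factorial R).mul_left _).mul_left 2)) ?_
  · refine ContinuousOn.mul (ContinuousOn.rpow_const ?_ fun c hc => Or.inr (by linarith))
      continuousOn_const
    unfold mix tilt likeRatio
    fun_prop
  · rintro i ⟨w, s, t⟩ ⟨⟨h0, h1⟩, ⟨hs0, hs1⟩, ht0, ht1⟩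
    dsimp only at h0 h1 hs0 hs1 ht0 ht1
    have ht : 0 ≤ t := hτ.le.trans ht0
    have m0 : 0 ≤ mix b τ (w, s, t) i := add_nonneg (mul_nonneg (by dsimp only; linarith)
      (hA _ i hs0)) (mul_nonneg h0 (hA _ i ht))
    have m1 : mix b τ (w, s, t) i ≤ tilt b τ s * likeRatio τ s i + tilt b τ t * likeRatio τ t i :=
      add_le_add (mul_le_of_le_one_left (hA _ i hs0) (by dsimp only; linarith))
        (mul_le_of_le_one_left (hA _ i ht) h1)
    have p := poiReal_pos hτ i
    rw [Real.norm_of_nonneg (mul_nonneg (Real.rpow_nonneg m0 _) p.le)]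
    have amgm := Real.geom_mean_le_arith_mean2_weighted (by linarith : 0 ≤ 1 - u) hu.le m0
      zero_le_one (by ring)
    rw [Real.one_rpow, mul_one, mul_one] at amgm
    have h2 : mix b τ (w, s, t) i ^ (1 - u) ≤
        1 + (tilt b τ s * likeRatio τ s i + tilt b τ t * likeRatio τ t i) := by
      nlinarith
    have bd : ∀ x, 0 ≤ x → x ≤ R → tilt b τ x * likeRatio τ x i * poiReal τ i ≤
        Real.exp (b * R) * (R ^ i / (i.factorial : ℝ)) := fun x hx hxR => by
      rw [mul_assoc, likeRatio_mul_poiReal hτ]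
      have e1 : Real.exp (-x) ≤ 1 := Real.exp_le_one_iff.2 (by linarith)
      have e2 : |x - τ| ≤ R := abs_le.2 ⟨by linarith, by linarith⟩
      unfold tilt
      refine mul_le_mul (Real.exp_le_exp.2 (mul_le_mul_of_nonneg_left e2 hb.le))
        ((mul_le_of_le_one_left (by positivity) e1).trans ?_) (by positivity) (by positivity)
      gcongr
    have p1 : poiReal τ i ≤ τ ^ i / (i.factorial : ℝ) :=
      mul_le_of_le_one_left (by positivity) (Real.exp_le_one_iff.2 (by linarith))
    have := mul_le_mul_of_nonneg_right h2 p.le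
    have b1 := bd s hs0 (hs1.trans hR)
    have b2 := bd t ht ht1
    nlinarith

/-- With `r = x/τ`, the exponent is a constant plus `τ r^{1-u} (1 - (1-u)(1-b) r^u)`, which tends to
`-∞` because `b < 1`. -/
theorem tendsto_pointAffinity {u b τ : ℝ} (hu : 0 < u) (hu1 : u < 1) (hb1 : b < 1) (hτ : 0 < τ) :
    Tendsto (pointAffinity u b τ) atTop (𝓝 0) := by
  have h1 : Tendsto (fun r : ℝ => r ^ (1 - u) * (1 - (1 - u) * (1 - b) * r ^ u)) atTop atBot := by
    refine (tendsto_rpow_atTop (by linarith : 0 < 1 - u)).atTop_mul_atBot₀ ?_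
    refine tendsto_atBot_add_const_left _ _ ?_
    refine Tendsto.comp tendsto_neg_atTop_atBot ((tendsto_rpow_atTop hu).const_mul_atTop ?_)
    exact mul_pos (by linarith) (by linarith)
  have h2 := (h1.comp (tendsto_id.atTop_div_const hτ)).const_mul_atBot hτ
  have h3 := Real.tendsto_exp_atBot.comp
    (tendsto_atBot_add_const_right _ ((1 - u) * τ - (1 - u) * b * τ - τ) h2)
  refine h3.congr' ?_
  filter_upwards [eventually_ge_atTop τ] with x hx
  have hr : 0 < x / τ := div_pos (hτ.trans_le hx) hτ
  have e : (x / τ) ^ (1 - u) * (x / τ) ^ u = x / τ := by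
    rw [← Real.rpow_add hr]; simp
  simp only [Function.comp, id, pointAffinity, abs_of_nonneg (sub_nonneg.2 hx)]
  congr 1
  have e2 : τ * (x / τ) = x := by field_simp
  linear_combination (-(τ * (1 - u) * (1 - b))) * e - (1 - u) * (1 - b) * e2

theorem rpow_reflection {v r : ℝ} (hv0 : 0 < v) (hv1 : v < 1) (hr : 0 < r) (hr1 : r ≤ 1) :
    2 * v * r < (1 + r) ^ v - (1 - r) ^ v := by
  have hd : ∀ x : ℝ, x ∈ Ioo 0 1 → HasDerivAt
      (fun x : ℝ => (1 + x) ^ v - (1 - x) ^ v - 2 * v * x)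
      (v * ((1 + x) ^ (v - 1) + (1 - x) ^ (v - 1) - 2)) x := fun x hx => by
    have d1 := ((hasDerivAt_id x).const_add 1).rpow_const (p := v) (Or.inl (by simp; linarith [hx.1]))
    have d2 := ((hasDerivAt_id x).const_sub 1).rpow_const (p := v) (Or.inl (by simp; linarith [hx.2]))
    have d3 := (hasDerivAt_id x).const_mul (2 * v)
    refine ((d1.sub d2).sub d3).congr_deriv ?_
    simp only [id]
    ring
  have hmono : StrictMonoOn (fun x : ℝ => (1 + x) ^ v - (1 - x) ^ v - 2 * v * x) (Icc 0 1) := by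
    refine strictMonoOn_of_deriv_pos (convex_Icc 0 1) ?_ fun x hx => ?_
    · refine ContinuousOn.sub (ContinuousOn.sub ?_ ?_) (by fun_prop)
      · exact ContinuousOn.rpow_const (by fun_prop) fun _ _ => Or.inr hv0.le
      · exact ContinuousOn.rpow_const (by fun_prop) fun _ _ => Or.inr hv0.le
    · rw [interior_Icc] at hx
      rw [(hd x hx).deriv]
      have p1 : 0 < 1 + x := by linarith [hx.1]
      have p2 : 0 < 1 - x := by linarith [hx.2]
      have q1 := Real.rpow_pos_of_pos p1 (v - 1)
      have q2 := Real.rpow_pos_of_pos p2 (v - 1)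
      -- The product of the two powers exceeds 1, so by AM-GM their sum exceeds 2 and the derivative
      -- is positive.
      have q : 1 < (1 + x) ^ (v - 1) * (1 - x) ^ (v - 1) := by
        rw [← Real.mul_rpow p1.le p2.le]
        exact Real.one_lt_rpow_of_pos_of_lt_one_of_neg (mul_pos p1 p2)
          (by nlinarith [hx.1]) (by linarith)
      refine mul_pos hv0 ?_
      nlinarith [sq_nonneg ((1 + x) ^ (v - 1) - (1 - x) ^ (v - 1))]
  have := hmono (left_mem_Icc.2 zero_le_one) ⟨hr.le, hr1⟩ hr
  simp at this
  linarith

/-- For `s < τ` the reflection `2τ - s` has the same tilt and wins by `rpow_reflection`. The point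
`τ` itself is beaten by `τ(1 + b)`, by Bernoulli's inequality. -/
theorem exists_pointAffinity_lt {u b τ s : ℝ} (hu : 0 < u) (hu1 : u < 1) (hb : 0 < b)
    (hτ : 0 < τ) (hs : 0 ≤ s) (hsτ : s ≤ τ) :
    ∃ t, τ ≤ t ∧ pointAffinity u b τ s < pointAffinity u b τ t := by
  rcases hsτ.eq_or_lt with rfl | hlt
  · refine ⟨s * (1 + b), by nlinarith, ?_⟩
    unfold pointAffinity
    rw [Real.exp_lt_exp]
    have e1 : s * (1 + b) - s = s * b := by ring
    have e2 : s * (1 + b) / s = 1 + b := by field_simp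
    rw [e1, e2, abs_of_pos (mul_pos hτ hb), div_self hτ.ne']
    have key : (1 + b) / (1 + u * b) ≤ (1 + b) ^ (1 - u) := by
      have hb' : 0 < 1 + b := by linarith
      have : (1 + b) ^ u ≤ 1 + u * b := by
        have := rpow_one_add_le_one_add_mul_self (s := b) (p := u) (by linarith) hu.le hu1.le
        exact this
      rw [Real.rpow_sub hb', Real.rpow_one]
      exact div_le_div_of_nonneg_left hb'.le (Real.rpow_pos_of_pos hb' _) this
    have key2 : (1 - u) * b - (1 - u) * (b * b) + 1 < (1 + b) / (1 + u * b) := by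
      rw [lt_div_iff₀ (by positivity)]
      have : 0 < b * b * ((1 - u) * (1 - u) + (1 - u) * u * b) := by
        have : 0 < 1 - u := by linarith
        positivity
      nlinarith
    have : (1 - u) * b - (1 - u) * (b * b) + 1 < (1 + b) ^ (1 - u) := key2.trans_le key
    have h3 := mul_lt_mul_of_pos_left this hτ
    simp only [sub_self, abs_zero, mul_zero, Real.one_rpow]
    nlinarith
  · refine ⟨2 * τ - s, by linarith, ?_⟩
    unfold pointAffinity
    rw [Real.exp_lt_exp]
    have h := rpow_reflection (v := 1 - u) (r := 1 - s / τ) (by linarith) (by linarith)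
      (sub_pos.2 ((div_lt_one hτ).2 hlt)) (by have : 0 ≤ s / τ := by positivity
                                              linarith)
    have e1 : 1 + (1 - s / τ) = (2 * τ - s) / τ := by field_simp; ring
    have e2 : 1 - (1 - s / τ) = s / τ := by ring
    have e3 : |2 * τ - s - τ| = |s - τ| := by rw [abs_sub_comm s]; congr 1; ring
    rw [e1, e2] at h
    rw [e3]
    have h' := mul_lt_mul_of_pos_left h hτ
    have e4 : τ * (2 * (1 - u) * (1 - s / τ)) = 2 * (1 - u) * (τ - s) := by field_simp
    rw [e4] at h'
    linarith

/-- The affinity attains its maximum, at a configuration with positive weight beyond `τ`. -/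
theorem exists_isMaxOn_affinity {u b τ : ℝ} (hu : 0 < u) (hu1 : u < 1) (hb : 0 < b) (hb1 : b < 1)
    (hτ : 0 < τ) : ∃ c ∈ configs τ, IsMaxOn (affinity u b τ) (configs τ) c := by
  have hcont : ContinuousOn (pointAffinity u b τ) (Icc 0 τ) := by
    unfold pointAffinity
    refine Real.continuous_exp.comp_continuousOn (ContinuousOn.add (by fun_prop) ?_)
    exact continuousOn_const.mul (ContinuousOn.rpow_const (by fun_prop)
      fun _ _ => Or.inr (by linarith))
  obtain ⟨s₀, hs₀, hmax₀⟩ := isCompact_Icc.exists_isMaxOn (nonempty_Icc.2 hτ.le) hcont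
  obtain ⟨t₀, ht₀, hlt⟩ := exists_pointAffinity_lt hu hu1 hb hτ hs₀.1 hs₀.2
  -- Beyond `R₀` a point's affinity is below the gap between `t₀` and `s₀`, so by `affinity_le` a
  -- configuration reaching that far does not exceed the value of `(1, s₀, t₀)`.
  obtain ⟨R₀, hR₀⟩ := eventually_atTop.1 ((tendsto_pointAffinity hu hu1 hb1 hτ).eventually_lt_const
    (sub_pos.2 hlt))
  set R := max R₀ t₀
  have hτR : τ ≤ R := ht₀.trans (le_max_right _ _)
  have hmem : ((1, s₀, t₀) : ℝ × ℝ × ℝ) ∈ Icc (0 : ℝ) 1 ×ˢ Icc 0 τ ×ˢ Icc τ R :=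
    ⟨⟨zero_le_one, le_rfl⟩, hs₀, ht₀, le_max_right _ _⟩
  obtain ⟨⟨w, s, t⟩, ⟨⟨hw0, hw1⟩, hs, ht, htR⟩, hmax⟩ :=
    (isCompact_Icc.prod (isCompact_Icc.prod isCompact_Icc)).exists_isMaxOn ⟨_, hmem⟩
      (continuousOn_affinity hu hu1 hb hτ R hτR)
  dsimp only at hw0 hw1 hs ht htR
  have hge : pointAffinity u b τ t₀ ≤ affinity u b τ (w, s, t) := by
    rw [← affinity_one u b τ s₀ t₀ hτ (hτ.le.trans ht₀)]
    exact hmax hmem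
  refine ⟨(w, s, t), ⟨?_, hw1, hs.1, hs.2, ht⟩, ?_⟩
  · refine hw0.lt_of_ne ?_
    rintro rfl
    rw [affinity_zero u b τ s t hτ hs.1] at hge
    exact (hlt.trans_le (hge.trans (hmax₀ hs))).false
  · rintro ⟨w', s', t'⟩ ⟨h1, h2, h3, h4, h5⟩
    rcases le_total t' R with h | h
    · exact hmax ⟨⟨h1.le, h2⟩, ⟨h3, h4⟩, h5, h⟩
    · refine (affinity_le hu hu1 hτ h1.le h2 h3 (hτ.le.trans h5)).trans (le_trans ?_ hge)
      have a1 : pointAffinity u b τ s' ≤ pointAffinity u b τ s₀ := hmax₀ ⟨h3, h4⟩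
      have a2 := hR₀ t' ((le_max_left _ _).trans h)
      dsimp only
      linarith

/-! ### Optimality conditions at a maximizer -/

theorem gain_pos {u b τ z : ℝ} (hu : 0 < u) (hb : 0 < b) (hτ : 0 < τ) {c : ℝ × ℝ × ℝ}
    (hc : c ∈ configs τ) (hz : 0 ≤ z) : 0 < gain b τ (wt u b τ c) z := by
  obtain ⟨C, hC⟩ := exists_abs_wt_le (u := u) hu hb hτ hc
  exact mul_pos (tilt_pos _ _ _) (mul_pos (Real.exp_pos _) (egf_pos hC (wt_pos hb hτ hc) hz))

/-- On either side of `τ` the gain is log-concave. -/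
theorem gain_le_of_segment {u b τ x z ε : ℝ} (hu : 0 < u) (hb : 0 < b) (hτ : 0 < τ)
    {c : ℝ × ℝ × ℝ} (hc : c ∈ configs τ) (hx : 0 ≤ x) (hz : 0 ≤ z) (hε : 0 < ε) (hε1 : ε < 1)
    (hside : |x + ε * (z - x) - τ| = (1 - ε) * |x - τ| + ε * |z - τ|)
    (hle : gain b τ (wt u b τ c) (x + ε * (z - x)) ≤ gain b τ (wt u b τ c) x) :
    gain b τ (wt u b τ c) z ≤ gain b τ (wt u b τ c) x := by
  obtain ⟨C, hC⟩ := exists_abs_wt_le (u := u) hu hb hτ hc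
  have hx' : 0 ≤ x + ε * (z - x) := by nlinarith
  have hconc := (concaveOn_log_egf hC (wt_pos hb hτ hc) (wt_logConcave hu hb hτ hc)).2
    (mem_Ici.2 hx) (mem_Ici.2 hz) (by linarith : 0 ≤ 1 - ε) hε.le (by ring)
  have hlog : ∀ z, 0 ≤ z → Real.log (gain b τ (wt u b τ c) z) =
      b * |z - τ| - z + Real.log (egf (wt u b τ c) z) := fun z hz => by
    have := egf_pos hC (wt_pos hb hτ hc) hz
    rw [gain, tilt, Real.log_mul (Real.exp_pos _).ne' (by positivity),
      Real.log_mul (Real.exp_pos _).ne' this.ne', Real.log_exp, Real.log_exp]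
    ring
  have h1 := Real.log_le_log (gain_pos hu hb hτ hc hx') hle
  rw [← Real.log_le_log_iff (gain_pos hu hb hτ hc hz) (gain_pos hu hb hτ hc hx)]
  rw [hlog _ hx', hlog _ hx, hside] at h1
  rw [hlog _ hx, hlog _ hz]
  simp only [smul_eq_mul] at hconc
  rw [show (1 - ε) * x + ε * z = x + ε * (z - x) by ring] at hconc
  refine le_of_mul_le_mul_left ?_ hε
  nlinarith

/-- The comparison is made with the weights of a perturbed configuration and passes to the limit by
continuity, so the affinity is never differentiated. -/
theorem gain_le_of_path {u b τ x z : ℝ} (hu : 0 < u) (hb : 0 < b) (hτ : 0 < τ)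
    {c : ℝ × ℝ × ℝ} (hc : c ∈ configs τ) {γ : ℝ → ℝ × ℝ × ℝ} (hγ : Continuous γ) (h0 : γ 0 = c)
    (hmem : ∀ ε, 0 < ε → ε < 1 → γ ε ∈ configs τ)
    (hle : ∀ ε, 0 < ε → ε < 1 → gain b τ (wt u b τ (γ ε)) z ≤ gain b τ (wt u b τ (γ ε)) x) :
    gain b τ (wt u b τ c) z ≤ gain b τ (wt u b τ c) x := by
  have hw : 0 < c.1 := hc.1
  have hlim : Tendsto γ (𝓝[>] 0) (𝓝 c) := h0 ▸ (hγ.tendsto 0).mono_left nhdsWithin_le_nhds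
  have h1 : ∀ᶠ ε : ℝ in 𝓝[>] 0, 0 < ε ∧ ε < 1 := by
    filter_upwards [Ioo_mem_nhdsGT (zero_lt_one (α := ℝ))] with ε hε using hε
  have h2 : Tendsto γ (𝓝[>] 0)
      (𝓝[configs τ ∩ {d | c.1 / 2 ≤ d.1 ∧ d.2.2 ≤ c.2.2 + 1}] c) := by
    refine tendsto_nhdsWithin_iff.2 ⟨hlim, ?_⟩
    have e1 : ∀ᶠ d : ℝ × ℝ × ℝ in 𝓝 c, c.1 / 2 < d.1 :=
      continuous_fst.continuousAt.eventually_const_lt (half_lt_self hw)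
    have e2 : ∀ᶠ d : ℝ × ℝ × ℝ in 𝓝 c, d.2.2 < c.2.2 + 1 :=
      (continuous_snd.snd).continuousAt.eventually_lt_const (lt_add_one _)
    filter_upwards [h1, hlim.eventually e1, hlim.eventually e2] with ε hε a1 a2
    exact ⟨hmem ε hε.1 hε.2, a1.le, a2.le⟩
  have key : ∀ z, Tendsto (fun ε => gain b τ (wt u b τ (γ ε)) z) (𝓝[>] 0)
      (𝓝 (gain b τ (wt u b τ c) z)) := fun z =>
    ((((continuousOn_egf_wt hu hb hτ (c.1 / 2) (c.2.2 + 1) z (half_pos hw)) c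
      ⟨hc, (half_lt_self hw).le, (lt_add_one _).le⟩).tendsto.comp h2).const_mul _).const_mul _
  refine le_of_tendsto_of_tendsto (key z) (key x) ?_
  filter_upwards [h1] with ε hε using hle ε hε.1 hε.2

section Maximizer

variable {u b τ : ℝ} (hu : 0 < u) (hu1 : u < 1) (hb : 0 < b) (hτ : 0 < τ) {w s t : ℝ}
  (hc : (w, s, t) ∈ configs τ) (hmax : IsMaxOn (affinity u b τ) (configs τ) (w, s, t))

include hu hu1 hb hτ hc hmax

/-- Moving `t` slightly towards `z` cannot improve the maximizer. Log-concavity carries the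
resulting comparison from the moved point on to `z`. -/
theorem gain_le_right {z : ℝ} (hz : τ ≤ z) :
    gain b τ (wt u b τ (w, s, t)) z ≤ gain b τ (wt u b τ (w, s, t)) t := by
  obtain ⟨h1, h2, h3, h4, h5⟩ := id hc
  dsimp only at h1 h2 h3 h4 h5
  have hτx : ∀ ε : ℝ, 0 < ε → ε < 1 → τ ≤ t + ε * (z - t) := fun ε h0 h1 => by nlinarith
  have hm : ∀ ε : ℝ, 0 < ε → ε < 1 → (w, s, t + ε * (z - t)) ∈ configs τ :=
    fun ε e0 e1 => ⟨h1, h2, h3, h4, hτx ε e0 e1⟩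
  refine gain_le_of_path hu hb hτ hc (γ := fun ε => (w, s, t + ε * (z - t))) (by fun_prop)
    (by simp) hm fun ε e0 e1 => ?_
  have h := gain_comparison hu hu1 hb hτ hc (hm ε e0 e1) (hmax (hm ε e0 e1))
  dsimp only at h
  refine gain_le_of_segment hu hb hτ (hm ε e0 e1) (hτ.le.trans h5) (hτ.le.trans hz) e0 e1 ?_
    (le_of_mul_le_mul_left (by linarith) h1)
  rw [abs_of_nonneg (sub_nonneg.2 (hτx ε e0 e1)), abs_of_nonneg (sub_nonneg.2 h5),
    abs_of_nonneg (sub_nonneg.2 hz)]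
  ring

theorem gain_le_left (hw1 : w < 1) {z : ℝ} (hz0 : 0 ≤ z) (hz : z ≤ τ) :
    gain b τ (wt u b τ (w, s, t)) z ≤ gain b τ (wt u b τ (w, s, t)) s := by
  obtain ⟨h1, h2, h3, h4, h5⟩ := id hc
  dsimp only at h1 h2 h3 h4 h5
  have hx : ∀ ε : ℝ, 0 < ε → ε < 1 → s + ε * (z - s) ≤ τ := fun ε h0 h1 => by nlinarith
  have hm : ∀ ε : ℝ, 0 < ε → ε < 1 → (w, s + ε * (z - s), t) ∈ configs τ :=
    fun ε e0 e1 => ⟨h1, h2, by dsimp only; nlinarith, hx ε e0 e1, h5⟩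
  refine gain_le_of_path hu hb hτ hc (γ := fun ε => (w, s + ε * (z - s), t)) (by fun_prop)
    (by simp) hm fun ε e0 e1 => ?_
  have h := gain_comparison hu hu1 hb hτ hc (hm ε e0 e1) (hmax (hm ε e0 e1))
  dsimp only at h
  refine gain_le_of_segment hu hb hτ (hm ε e0 e1) h3 hz0 e0 e1 ?_
    (le_of_mul_le_mul_left (a := 1 - w) (by linarith) (by linarith))
  rw [abs_of_nonpos (sub_nonpos.2 (hx ε e0 e1)), abs_of_nonpos (sub_nonpos.2 h4),
    abs_of_nonpos (sub_nonpos.2 hz)]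
  ring

theorem gain_left_le_right :
    gain b τ (wt u b τ (w, s, t)) s ≤ gain b τ (wt u b τ (w, s, t)) t := by
  obtain ⟨h1, h2, h3, h4, h5⟩ := id hc
  dsimp only at h1 h2 h3 h4 h5
  have hm : ∀ ε : ℝ, 0 < ε → ε < 1 → (w - ε * w, s, t) ∈ configs τ :=
    fun ε e0 e1 => ⟨by dsimp only; nlinarith, by dsimp only; nlinarith, h3, h4, h5⟩
  refine gain_le_of_path hu hb hτ hc (γ := fun ε => (w - ε * w, s, t)) (by fun_prop)
    (by simp) hm fun ε e0 e1 => ?_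
  have h := gain_comparison hu hu1 hb hτ hc (hm ε e0 e1) (hmax (hm ε e0 e1))
  dsimp only at h
  exact le_of_mul_le_mul_left (a := ε * w) (by linarith) (by positivity)

theorem gain_right_le_left (hw1 : w < 1) :
    gain b τ (wt u b τ (w, s, t)) t ≤ gain b τ (wt u b τ (w, s, t)) s := by
  obtain ⟨h1, h2, h3, h4, h5⟩ := id hc
  dsimp only at h1 h2 h3 h4 h5
  have hm : ∀ ε : ℝ, 0 < ε → ε < 1 → (w + ε * (1 - w), s, t) ∈ configs τ :=
    fun ε e0 e1 => ⟨by dsimp only; nlinarith, by dsimp only; nlinarith, h3, h4, h5⟩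
  refine gain_le_of_path hu hb hτ hc (γ := fun ε => (w + ε * (1 - w), s, t)) (by fun_prop)
    (by simp) hm fun ε e0 e1 => ?_
  have h := gain_comparison hu hu1 hb hτ hc (hm ε e0 e1) (hmax (hm ε e0 e1))
  dsimp only at h
  exact le_of_mul_le_mul_left (a := ε * (1 - w)) (by linarith) (mul_pos e0 (by linarith))

/-- If all cost sat at `t`, the weights would be geometric and the log-gain affine on each side of
`τ`. Optimality at `t` forces slope at most 0 on the right, whereas the gain at 0 not exceeding that
at `t` forces a positive slope. -/
theorem maximizer_weight_lt_one : w < 1 := by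
  obtain ⟨h1, h2, h3, h4, h5⟩ := id hc
  dsimp only at h1 h2 h3 h4 h5
  refine h2.lt_of_ne ?_
  rintro rfl
  have ht : 0 < t := hτ.trans_le h5
  -- With `w = 1` the left point carries no mass, so it may be moved to 0.
  have hmix : mix b τ (1, 0, t) = mix b τ (1, s, t) := by ext i; simp [mix]
  have hwt : wt u b τ (1, 0, t) = wt u b τ (1, s, t) := by ext i; simp [wt, hmix]
  have haff : affinity u b τ (1, 0, t) = affinity u b τ (1, s, t) := by simp [affinity, hmix]
  have hc0 : ((1, 0, t) : ℝ × ℝ × ℝ) ∈ configs τ := ⟨h1, h2, le_rfl, hτ.le, h5⟩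
  have hmax0 : IsMaxOn (affinity u b τ) (configs τ) (1, 0, t) := fun d hd =>
    (hmax hd).trans haff.ge
  have g0 := gain_left_le_right hu hu1 hb hτ hc0 hmax0
  rw [hwt] at g0
  have g1 := gain_le_right hu hu1 hb hτ hc hmax (z := t + 1) (by linarith)
  set ρ := (t / τ) ^ (-u)
  set K := (tilt b τ t * Real.exp (τ - t)) ^ (-u)
  have hK : 0 < K := Real.rpow_pos_of_pos (mul_pos (tilt_pos _ _ _) (Real.exp_pos _)) _
  have hr : 0 ≤ t / τ := by positivity
  have hgain : ∀ z, gain b τ (wt u b τ (1, s, t)) z =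
      K * Real.exp (b * |z - τ| - z + ρ * z) := fun z => by
    have e := (NormedSpace.expSeries_div_hasSum_exp (𝔸 := ℝ) (ρ * z)).mul_left K
    rw [← Real.exp_eq_exp_ℝ] at e
    have : egf (wt u b τ (1, s, t)) z = K * Real.exp (ρ * z) := by
      rw [← e.tsum_eq, egf]
      refine tsum_congr fun i => ?_
      have : mix b τ (1, s, t) i = tilt b τ t * Real.exp (τ - t) * (t / τ) ^ i := by
        simp only [mix, likeRatio]; ring
      rw [wt, this, Real.mul_rpow (mul_pos (tilt_pos _ _ _) (Real.exp_pos _)).le (by positivity),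
        ← Real.rpow_natCast (t / τ), ← Real.rpow_mul hr, mul_comm (i : ℝ), Real.rpow_mul hr,
        Real.rpow_natCast, mul_pow]
      ring
    rw [gain, this, tilt, Real.exp_add, sub_eq_add_neg (b * _) z, Real.exp_add]
    ring
  rw [hgain, hgain, mul_le_mul_iff_right₀ hK, Real.exp_le_exp] at g0 g1
  rw [abs_of_nonneg (by linarith : (0 : ℝ) ≤ t - τ)] at g0 g1
  rw [abs_of_nonneg (by linarith : (0 : ℝ) ≤ t + 1 - τ)] at g1
  rw [zero_sub, abs_neg, abs_of_pos hτ] at g0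
  have hσ : b - 1 + ρ ≤ 0 := by linarith
  nlinarith [mul_nonpos_of_nonpos_of_nonneg hσ ht.le, mul_pos hb hτ]

theorem gain_le_affinity {z : ℝ} (hz : 0 ≤ z) :
    gain b τ (wt u b τ (w, s, t)) s = affinity u b τ (w, s, t) ∧
    gain b τ (wt u b τ (w, s, t)) t = affinity u b τ (w, s, t) ∧
    gain b τ (wt u b τ (w, s, t)) z ≤ affinity u b τ (w, s, t) := by
  have hw1 := maximizer_weight_lt_one hu hu1 hb hτ hc hmax
  have e := (gain_left_le_right hu hu1 hb hτ hc hmax).antisymm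
    (gain_right_le_left hu hu1 hb hτ hc hmax hw1)
  have e2 := (hasSum_affinity (u := u) hu hb hτ hc).2
  dsimp only at e2
  rw [e] at e2
  have e3 : affinity u b τ (w, s, t) = gain b τ (wt u b τ (w, s, t)) t := by linarith
  refine ⟨e.trans e3.symm, e3.symm, ?_⟩
  rw [e3]
  rcases le_total z τ with h | h
  · exact (gain_le_left hu hu1 hb hτ hc hmax hw1 hz h).trans e.le
  · exact gain_le_right hu hu1 hb hτ hc hmax h

/-- A maximum of `e^{b|z-τ|} g(z)` at the kink `τ` would make `τ` a local maximum both of `g` and of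
the smaller function `(1 + b(z-τ)) g(z)`, so that `g' = 0` and `b g + g' = 0`, against `g > 0`. -/
theorem gain_ne_affinity : gain b τ (wt u b τ (w, s, t)) τ ≠ affinity u b τ (w, s, t) := by
  intro heq
  obtain ⟨C, hC⟩ := exists_abs_wt_le (u := u) hu hb hτ hc
  set W := wt u b τ (w, s, t)
  set g : ℝ → ℝ := fun z => Real.exp (-z) * egf W z with hg
  have gpos : ∀ z, 0 ≤ z → 0 < g z := fun z hz =>
    mul_pos (Real.exp_pos _) (egf_pos hC (wt_pos hb hτ hc) hz)
  have hle : ∀ z, 0 ≤ z → Real.exp (b * |z - τ|) * g z ≤ g τ := fun z hz => by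
    have := (gain_le_affinity hu hu1 hb hτ hc hmax hz).2.2.trans heq.ge
    simpa [gain, tilt] using this
  obtain ⟨g', hg'⟩ : ∃ g', HasDerivAt g g' τ :=
    ⟨_, ((hasDerivAt_neg τ).exp).mul (hasDerivAt_egf hC τ)⟩
  have hnhds : ∀ᶠ z in 𝓝 τ, 0 ≤ z := (eventually_gt_nhds hτ).mono fun z hz => hz.le
  have d0 : g' = 0 := by
    refine IsLocalMax.hasDerivAt_eq_zero (a := τ) ?_ hg'
    filter_upwards [hnhds] with z hz
    exact (le_mul_of_one_le_left (gpos z hz).le (one_le_tilt hb τ z)).trans (hle z hz)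
  have hd : HasDerivAt (fun z => (1 + b * (z - τ)) * g z) (b * g τ + g') τ := by
    have h1 : HasDerivAt (fun z : ℝ => 1 + b * (z - τ)) b τ := by
      simpa using (((hasDerivAt_id τ).sub_const τ).const_mul b).const_add 1
    exact (h1.mul hg').congr_deriv (by simp)
  have d1 : b * g τ + g' = 0 := by
    refine IsLocalMax.hasDerivAt_eq_zero (a := τ) ?_ hd
    filter_upwards [hnhds] with z hz
    have h1 : 1 + b * (z - τ) ≤ Real.exp (b * |z - τ|) := by
      have h2 := Real.add_one_le_exp (b * |z - τ|)
      have h3 := mul_le_mul_of_nonneg_left (le_abs_self (z - τ)) hb.le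
      linarith
    have := (mul_le_mul_of_nonneg_right h1 (gpos z hz).le).trans (hle z hz)
    simpa using this
  have := mul_pos hb (gpos τ hτ.le)
  linarith

end Maximizer

/-- There is a two-point mixture, with one point on either side of `τ`, whose gain is bounded by
its affinity. -/
theorem exists_saddlePoint {u b τ : ℝ} (hu : 0 < u) (hu1 : u < 1) (hb : 0 < b) (hb1 : b < 1)
    (hτ : 0 < τ) : ∃ w s t : ℝ, 0 < w ∧ w < 1 ∧ 0 ≤ s ∧ s < τ ∧ τ < t ∧
      ∀ z, 0 ≤ z → gain b τ (wt u b τ (w, s, t)) z ≤ affinity u b τ (w, s, t) := by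
  obtain ⟨⟨w, s, t⟩, hc, hmax⟩ := exists_isMaxOn_affinity hu hu1 hb hb1 hτ
  have h := fun z hz => gain_le_affinity hu hu1 hb hτ hc hmax (z := z) hz
  have hne := gain_ne_affinity hu hu1 hb hτ hc hmax
  have hw := maximizer_weight_lt_one hu hu1 hb hτ hc hmax
  obtain ⟨h1, h2, h3, h4, h5⟩ := hc
  refine ⟨w, s, t, h1, hw, h3, lt_of_le_of_ne h4 ?_, lt_of_le_of_ne h5 ?_,
    fun z hz => (h z hz).2.2⟩
  · rintro rfl; exact hne (h 0 le_rfl).1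
  · rintro rfl; exact hne (h 0 le_rfl).2.1

/-! ### The extended objectives -/

theorem coe_mul_log (h : ℝ) (z : ℝ≥0∞) : (h : EReal) * ENNReal.log z = ENNReal.log (z ^ h) :=
  ENNReal.log_rpow.symm

theorem coe_eq_log (x : ℝ) : (x : EReal) = ENNReal.log (ENNReal.ofReal (Real.exp x)) := by
  rw [ENNReal.log_ofReal_of_pos (Real.exp_pos x), Real.log_exp]

/-- The sum `∑ᵢ e^{(1-u)κᵢ} poi(ky,i)`. -/
noncomputable def nullSum (k y : ℝ≥0) (u : ℝ) (κ : ℕ → ℝ) : ℝ≥0∞ :=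
  ∑' i, ENNReal.ofReal (Real.exp ((1 - u) * κ i)) * poi (k * y) i

/-- `e^{-α|x-y|} ∑ᵢ e^{-uκᵢ} poi(kx,i)`. -/
noncomputable def altSum (k y : ℝ≥0) (α u : ℝ) (κ : ℕ → ℝ) (x : ℝ≥0) : ℝ≥0∞ :=
  ENNReal.ofReal (Real.exp (-α * |(x : ℝ) - y|)) *
    ∑' i, ENNReal.ofReal (Real.exp (-u * κ i)) * poi (k * x) i

theorem innerObjective_eq (k y : ℝ≥0) {h : ℝ} (hh : 0 < h) (α u : ℝ) (κ : ℕ → ℝ) :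
    innerObjective k y h α u κ =
      h * ENNReal.log (nullSum k y u κ ^ u * (⨆ x, altSum k y α u κ x) ^ (1 - u)) := by
  have hsup : ENNReal.log (⨆ x, altSum k y α u κ x) =
      ⨆ x : ℝ≥0, (((-α * |(x : ℝ) - y| : ℝ) : EReal) +
        ENNReal.log (∑' i, ENNReal.ofReal (Real.exp (-u * κ i)) * poi (k * x) i)) := by
    rw [← ENNReal.logOrderIso_apply, ENNReal.logOrderIso.map_iSup]
    refine iSup_congr fun x => ?_
    rw [ENNReal.logOrderIso_apply, altSum, ENNReal.log_mul_add, ← coe_eq_log]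
  rw [innerObjective, ← hsup, coe_mul_log (u * h), coe_mul_log ((1 - u) * h), coe_mul_log h,
    ENNReal.mul_rpow_of_nonneg _ _ hh.le, ← ENNReal.rpow_mul, ← ENNReal.rpow_mul,
    ENNReal.log_mul_add, nullSum]

theorem tsum_rpow_mul_rpow_le (f g : ℕ → ℝ≥0∞) {u : ℝ} (hu : 0 < u) (hu1 : u < 1) :
    ∑' i, f i ^ (1 - u) * g i ^ u ≤ (∑' i, f i) ^ (1 - u) * (∑' i, g i) ^ u := by
  simp only [← MeasureTheory.lintegral_count]
  exact ENNReal.lintegral_mul_norm_pow_le (measurable_of_countable f).aemeasurable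
    (measurable_of_countable g).aemeasurable (by linarith) hu.le (by ring)

theorem dualObjective_le_innerObjective (k y : ℝ≥0) {h : ℝ} (hh : 0 < h) (α : ℝ) {u : ℝ}
    (hu : 0 < u) (hu1 : u < 1) (a : ℝ≥0 → ℝ≥0) (κ : ℕ → ℝ) :
    dualObjective k y h α u a ≤ innerObjective k y h α u κ := by
  rw [innerObjective_eq k y hh, dualObjective, coe_mul_log, coe_mul_log]
  refine ENNReal.log_le_log (ENNReal.rpow_le_rpow (ENNReal.div_le_of_le_mul ?_) hh.le)
  set m : ℕ → ℝ≥0∞ := fun i => ∑' x : ℝ≥0, (a x : ℝ≥0∞) * poi (k * x) i with hm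
  set S := ⨆ x, altSum k y α u κ x
  -- The factors in `κ` cancel; this splitting is the one to which Hölder applies.
  have h1 : ∀ i, m i ^ (1 - u) * poi (k * y) i ^ u =
      (ENNReal.ofReal (Real.exp (-u * κ i)) * m i) ^ (1 - u) *
      (ENNReal.ofReal (Real.exp ((1 - u) * κ i)) * poi (k * y) i) ^ u := fun i => by
    rw [ENNReal.mul_rpow_of_nonneg _ _ (by linarith : 0 ≤ 1 - u),
      ENNReal.mul_rpow_of_nonneg _ _ hu.le, ENNReal.ofReal_rpow_of_pos (Real.exp_pos _),
      ENNReal.ofReal_rpow_of_pos (Real.exp_pos _), mul_mul_mul_comm,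
      ← ENNReal.ofReal_mul (by positivity), ← Real.exp_mul, ← Real.exp_mul, ← Real.exp_add,
      show -u * κ i * (1 - u) + (1 - u) * κ i * u = 0 by ring]
    simp
  have h2 : ∑' i, ENNReal.ofReal (Real.exp (-u * κ i)) * m i ≤
      (∑' x : ℝ≥0, (a x : ℝ≥0∞) * ENNReal.ofReal (Real.exp (α * |(x : ℝ) - y|))) * S := by
    simp only [hm, ← ENNReal.tsum_mul_left]
    rw [ENNReal.tsum_comm, ← ENNReal.tsum_mul_right]
    refine ENNReal.tsum_le_tsum fun x => ?_
    have e1 : ENNReal.ofReal (Real.exp (α * |(x : ℝ) - y|)) *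
        ENNReal.ofReal (Real.exp (-α * |(x : ℝ) - y|)) = 1 := by
      rw [← ENNReal.ofReal_mul (by positivity), ← Real.exp_add,
        show α * |(x : ℝ) - y| + -α * |(x : ℝ) - y| = 0 by ring]
      simp
    calc ∑' i, ENNReal.ofReal (Real.exp (-u * κ i)) * ((a x : ℝ≥0∞) * poi (k * x) i)
        = a x * ∑' i, ENNReal.ofReal (Real.exp (-u * κ i)) * poi (k * x) i := by
          rw [← ENNReal.tsum_mul_left]
          exact tsum_congr fun i => mul_left_comm _ _ _
      _ = a x * ENNReal.ofReal (Real.exp (α * |(x : ℝ) - y|)) * altSum k y α u κ x := by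
          rw [altSum, mul_assoc, ← mul_assoc (ENNReal.ofReal (Real.exp (α * _))), e1, one_mul]
      _ ≤ _ := mul_le_mul_right (le_iSup (altSum k y α u κ) x) _
  refine (tsum_congr h1).trans_le ((tsum_rpow_mul_rpow_le _ _ hu hu1).trans ?_)
  rw [mul_comm (_ ^ (1 - u)), nullSum, mul_assoc]
  refine mul_le_mul_right ?_ _
  rw [← ENNReal.mul_rpow_of_nonneg _ _ (by linarith : 0 ≤ 1 - u), mul_comm S]
  exact ENNReal.rpow_le_rpow h2 (by linarith)

theorem poi_eq (r : ℝ≥0) (i : ℕ) :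
    poi r i = ENNReal.ofReal (Real.exp (-r) * ((r : ℝ) ^ i / (i.factorial : ℝ))) := by
  rw [poi, ProbabilityTheory.poissonMeasure_singleton, mul_div_assoc]

theorem poi_pos {r : ℝ≥0} (hr : 0 < r) (i : ℕ) : 0 < poi r i := by
  rw [poi_eq, ENNReal.ofReal_pos]
  have : (0 : ℝ) < r := hr
  positivity

theorem poi_div_poi {k y : ℝ≥0} (hk : 0 < k) (hy : 0 < y) (x : ℝ≥0) (i : ℕ) :
    poi (k * x) i / poi (k * y) i =
      ENNReal.ofReal (Real.exp (k * ((y : ℝ) - x)) * ((x : ℝ) / y) ^ i) := by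
  have hk' : (0 : ℝ) < k := hk
  have hy' : (0 : ℝ) < y := hy
  rw [poi_eq, poi_eq, ← ENNReal.ofReal_div_of_pos (by push_cast; positivity)]
  congr 1
  push_cast
  rw [show (k : ℝ) * ((y : ℝ) - x) = -(k * x) - -(k * y) by ring, Real.exp_sub, mul_pow, mul_pow,
    div_pow]
  field_simp

/-- When `α ≤ -k` the primal objective is infinite. -/
theorem innerObjective_eq_top {k y : ℝ≥0} (hk : 0 < k) (hy : 0 < y) {h : ℝ} (hh : 0 < h)
    {α u : ℝ} (hu : 0 < u) (hu1 : u < 1) (hα : α ≤ -(k : ℝ)) (κ : ℕ → ℝ) :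
    innerObjective k y h α u κ = ⊤ := by
  have hk' : (0 : ℝ) < k := hk
  have hsup : ⨆ x, altSum k y α u κ x = ⊤ := by
    refine ENNReal.eq_top_of_forall_nnreal_le fun r => ?_
    -- The single term `i = 1` already grows at least like `D x`. The term `i = 0` would not do,
    -- since it is bounded when `α = -k`.
    set D := Real.exp (-(k * y)) * Real.exp (-u * κ 1) * k with hD
    have hDpos : 0 < D := by positivity
    set x : ℝ≥0 := max y (r / D.toNNReal) with hx
    have hyx : (y : ℝ) ≤ x := by exact_mod_cast le_max_left _ _
    have hrx : (r : ℝ) ≤ D * x := by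
      have : r / D.toNNReal ≤ x := le_max_right _ _
      have h2 := NNReal.coe_le_coe.2 this
      rw [NNReal.coe_div, Real.coe_toNNReal _ hDpos.le, div_le_iff₀ hDpos] at h2
      linarith
    refine le_trans ?_ (le_iSup (altSum k y α u κ) x)
    rw [altSum]
    refine le_trans ?_ (mul_le_mul_right (ENNReal.le_tsum 1) _)
    rw [poi_eq, ← ENNReal.ofReal_mul (by positivity), ← ENNReal.ofReal_mul (by positivity),
      ← ENNReal.ofReal_coe_nnreal]
    refine ENNReal.ofReal_le_ofReal (hrx.trans ?_)
    rw [abs_of_nonneg (sub_nonneg.2 hyx)]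
    push_cast
    have e1 : Real.exp (k * ((x : ℝ) - y)) ≤ Real.exp (-α * ((x : ℝ) - y)) :=
      Real.exp_le_exp.2 (mul_le_mul_of_nonneg_right (by linarith) (sub_nonneg.2 hyx))
    have e2 : Real.exp (k * ((x : ℝ) - y)) * Real.exp (-(k * x)) = Real.exp (-(k * y)) := by
      rw [← Real.exp_add]; congr 1; ring
    have e3 := mul_le_mul_of_nonneg_right e1
      (by positivity : 0 ≤ Real.exp (-u * κ 1) * (Real.exp (-(k * x)) * (k * x)))
    simp only [pow_one, Nat.factorial_one, Nat.cast_one, div_one]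
    refine le_of_eq_of_le ?_ e3
    rw [hD, ← e2]
    ring
  have hnull : nullSum k y u κ ≠ 0 := by
    rw [nullSum, Ne, ENNReal.tsum_eq_zero]
    intro h0
    have := h0 0
    have hp := poi_pos (mul_pos hk hy) 0
    simp [hp.ne', Real.exp_pos, not_le.2] at this
  rw [innerObjective_eq k y hh, hsup, ENNReal.top_rpow_of_pos (by linarith), ENNReal.mul_top,
    ENNReal.log_top, EReal.coe_mul_top_of_pos hh]
  exact fun h0 => (ENNReal.rpow_eq_zero_iff.1 h0).elim (fun h0 => hnull h0.1)
    fun h0 => h0.2.not_gt hu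

/-! ### Two-point weights -/

/-- The weights `q` at `x₁` and `1 - q` at `x₂`. -/
noncomputable def pairWeight (x₁ x₂ : ℝ≥0) (q : ℝ) (x : ℝ≥0) : ℝ≥0 :=
  if x = x₁ then q.toNNReal else if x = x₂ then (1 - q).toNNReal else 0

/-- The likelihood ratio of the two-point mixture. -/
noncomputable def pairRatio (k y x₁ x₂ : ℝ≥0) (q : ℝ) (i : ℕ) : ℝ :=
  q * Real.exp (k * ((y : ℝ) - x₁)) * ((x₁ : ℝ) / y) ^ i +
    (1 - q) * Real.exp (k * ((y : ℝ) - x₂)) * ((x₂ : ℝ) / y) ^ i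

theorem tsum_pairWeight {x₁ x₂ : ℝ≥0} (hne : x₁ ≠ x₂) (q : ℝ) (f : ℝ≥0 → ℝ≥0∞) :
    ∑' x, (pairWeight x₁ x₂ q x : ℝ≥0∞) * f x =
      ENNReal.ofReal q * f x₁ + ENNReal.ofReal (1 - q) * f x₂ := by
  rw [tsum_eq_sum (s := {x₁, x₂}), Finset.sum_pair hne]
  · simp [pairWeight, hne.symm, ENNReal.ofReal]
  · intro x hx
    simp only [Finset.mem_insert, Finset.mem_singleton, not_or] at hx
    simp [pairWeight, hx.1, hx.2]

theorem pairRatio_pos {k y x₁ x₂ : ℝ≥0} {q : ℝ} (hy : 0 < y) (h2 : y < x₂) (hq0 : 0 < q)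
    (hq1 : q < 1) (i : ℕ) : 0 < pairRatio k y x₁ x₂ q i := by
  have hy' : (0 : ℝ) < y := hy
  have hx2 : (0 : ℝ) < x₂ := hy.trans h2
  have : 0 < 1 - q := by linarith
  unfold pairRatio
  positivity

theorem tsum_pairWeight_ratio {k y x₁ x₂ : ℝ≥0} {q : ℝ} (hk : 0 < k) (hy : 0 < y) (h1 : x₁ < y)
    (h2 : y < x₂) (hq0 : 0 < q) (hq1 : q < 1) (i : ℕ) :
    ∑' x : ℝ≥0, (pairWeight x₁ x₂ q x : ℝ≥0∞) * (poi (k * x) i / poi (k * y) i) =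
      ENNReal.ofReal (pairRatio k y x₁ x₂ q i) := by
  have : 0 < 1 - q := by linarith
  rw [tsum_pairWeight (h1.trans h2).ne, poi_div_poi hk hy, poi_div_poi hk hy,
    ← ENNReal.ofReal_mul hq0.le, ← ENNReal.ofReal_mul this.le,
    ← ENNReal.ofReal_add (by positivity) (by positivity), pairRatio, mul_assoc, mul_assoc]

theorem hasClosedForm_iff {k y : ℝ≥0} {b : ℝ≥0 → ℝ≥0} {M : ℕ → ℝ} (hM : ∀ i, 0 < M i) :
    HasClosedForm k y b (fun i => Real.log (M i)) ↔
      ∀ i, ∑' x : ℝ≥0, (b x : ℝ≥0∞) * (poi (k * x) i / poi (k * y) i) = ENNReal.ofReal (M i) := by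
  refine forall_congr' fun i => ?_
  rw [← ENNReal.log_ofReal_of_pos (hM i), ENNReal.log_eq_iff, eq_comm]

/-- The first five moments determine a nonnegative family that has two points. -/
theorem eq_pairWeight {k y x₁ x₂ : ℝ≥0} {q : ℝ} (hk : 0 < k) (hy : 0 < y) (h1 : x₁ < y)
    (h2 : y < x₂) (hq0 : 0 < q) (hq1 : q < 1) {b : ℝ≥0 → ℝ≥0}
    (hb : ∀ i, ∑' x : ℝ≥0, (b x : ℝ≥0∞) * (poi (k * x) i / poi (k * y) i) =
      ENNReal.ofReal (pairRatio k y x₁ x₂ q i)) : b = pairWeight x₁ x₂ q := by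
  have hy' : (0 : ℝ) < y := hy
  have hq : 0 < 1 - q := by linarith
  set e : ℝ≥0 → ℝ := fun x => Real.exp (k * ((y : ℝ) - x)) with he
  have epos : ∀ x, 0 < e x := fun x => Real.exp_pos _
  set r : ℝ≥0 → ℝ := fun x => (x : ℝ) / y with hr
  have rinj : ∀ x x', r x = r x' → x = x' := fun x x' h => by
    have := (div_left_inj' hy'.ne').1 h
    exact_mod_cast this
  have hsum : ∀ i : ℕ, HasSum (fun x => (b x : ℝ) * e x * r x ^ i)
      (q * e x₁ * r x₁ ^ i + (1 - q) * e x₂ * r x₂ ^ i) := fun i => by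
    have hi := hb i
    simp only [poi_div_poi hk hy] at hi
    have hfin : ∑' x : ℝ≥0, (b x : ℝ≥0∞) * ENNReal.ofReal (e x * r x ^ i) ≠ ⊤ := by
      rw [hi]; exact ENNReal.ofReal_ne_top
    have hs := ENNReal.hasSum_toReal hfin
    rw [← ENNReal.tsum_toReal_eq (fun x => ENNReal.ne_top_of_tsum_ne_top hfin x), hi,
      ENNReal.toReal_ofReal (pairRatio_pos hy h2 hq0 hq1 i).le] at hs
    refine hs.congr_fun fun x => ?_
    have : 0 ≤ e x * r x ^ i := mul_nonneg (epos x).le (pow_nonneg (by positivity) i)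
    rw [ENNReal.toReal_mul, ENNReal.toReal_ofReal this, ENNReal.coe_toReal, mul_assoc]
  -- A nonnegative quartic vanishing exactly at the two nodes has integral 0, so there is no mass
  -- elsewhere; the coefficients below are its expansion.
  have hpoly : HasSum (fun x => (b x : ℝ) * e x * ((r x - r x₁) ^ 2 * (r x - r x₂) ^ 2)) 0 := by
    have H := ((((hsum 4).add ((hsum 3).mul_left (-2 * (r x₁ + r x₂)))).add
      ((hsum 2).mul_left (r x₁ ^ 2 + 4 * r x₁ * r x₂ + r x₂ ^ 2))).add
      ((hsum 1).mul_left (-2 * (r x₁ ^ 2 * r x₂ + r x₁ * r x₂ ^ 2)))).add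
      ((hsum 0).mul_left (r x₁ ^ 2 * r x₂ ^ 2))
    have H' := H.congr_fun
      (g := fun x => (b x : ℝ) * e x * ((r x - r x₁) ^ 2 * (r x - r x₂) ^ 2)) fun x => by ring
    convert H' using 1
    ring
  have hzero : ∀ x, x ≠ x₁ → x ≠ x₂ → b x = 0 := fun x n1 n2 => by
    have hnn : ∀ x, 0 ≤ (b x : ℝ) * e x * ((r x - r x₁) ^ 2 * (r x - r x₂) ^ 2) := fun x =>
      mul_nonneg (mul_nonneg (b x).2 (epos x).le) (by positivity)
    have := congrFun ((hasSum_zero_iff_of_nonneg hnn).1 hpoly) x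
    have d1 : r x - r x₁ ≠ 0 := sub_ne_zero.2 fun h => n1 (rinj _ _ h)
    have d2 : r x - r x₂ ≠ 0 := sub_ne_zero.2 fun h => n2 (rinj _ _ h)
    simpa [(epos x).ne', d1, d2] using this
  have hne : x₁ ≠ x₂ := (h1.trans h2).ne
  have hpair : ∀ i : ℕ, (b x₁ : ℝ) * e x₁ * r x₁ ^ i + (b x₂ : ℝ) * e x₂ * r x₂ ^ i =
      q * e x₁ * r x₁ ^ i + (1 - q) * e x₂ * r x₂ ^ i := fun i => by
    rw [← (hsum i).tsum_eq, tsum_eq_sum (s := {x₁, x₂}), Finset.sum_pair hne]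
    intro x hx
    simp only [Finset.mem_insert, Finset.mem_singleton, not_or] at hx
    simp [hzero x hx.1 hx.2]
  have d : r x₁ - r x₂ ≠ 0 := sub_ne_zero.2 fun h => hne (rinj _ _ h)
  have p0 := hpair 0
  have p1 := hpair 1
  have b1 : (b x₁ : ℝ) = q := by
    have : ((b x₁ : ℝ) - q) * (e x₁ * (r x₁ - r x₂)) = 0 := by
      linear_combination p1 - r x₂ * p0
    rcases mul_eq_zero.1 this with h | h
    · linarith
    · exact absurd h (mul_ne_zero (epos _).ne' d)
  have b2 : (b x₂ : ℝ) = 1 - q := by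
    have : ((b x₂ : ℝ) - (1 - q)) * (e x₂ * (r x₁ - r x₂)) = 0 := by
      linear_combination r x₁ * p0 - p1
    rcases mul_eq_zero.1 this with h | h
    · linarith
    · exact absurd h (mul_ne_zero (epos _).ne' d)
  ext x
  unfold pairWeight
  split_ifs with g1 g2
  · rw [g1, b1, Real.coe_toNNReal _ hq0.le]
  · rw [g2, b2, Real.coe_toNNReal _ hq.le]
  · rw [hzero x g1 g2]

/-- `e^P + e^Q = 2 e^{(P+Q)/2} cosh((Q-P)/2)`, with `P` and `Q` affine in `i`. -/
theorem exists_log_cosh {p₁ p₂ r₁ r₂ : ℝ} (hp₁ : 0 < p₁) (hp₂ : 0 < p₂) (hr₁ : 0 < r₁)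
    (hr : r₁ < r₂) : ∃ A B C s : ℝ, 0 < C ∧ ∀ i : ℕ,
      Real.log (p₁ * r₁ ^ i + p₂ * r₂ ^ i) = A + B * i + Real.log (Real.cosh (C * (i - s))) := by
  have hr₂ : 0 < r₂ := hr₁.trans hr
  have hC : 0 < (Real.log r₂ - Real.log r₁) / 2 := by
    have := Real.log_lt_log hr₁ hr
    linarith
  refine ⟨(Real.log p₁ + Real.log p₂) / 2 + Real.log 2, (Real.log r₁ + Real.log r₂) / 2,
    (Real.log r₂ - Real.log r₁) / 2,
    (Real.log p₁ - Real.log p₂) / 2 / ((Real.log r₂ - Real.log r₁) / 2), hC, fun i => ?_⟩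
  rw [mul_sub, mul_div_cancel₀ _ hC.ne']
  have e : ∀ p r : ℝ, 0 < p → 0 < r → p * r ^ i = Real.exp (Real.log p + i * Real.log r) :=
    fun p r hp hr => by
      rw [Real.exp_add, Real.exp_log hp, mul_comm (i : ℝ), ← Real.rpow_def_of_pos hr,
        Real.rpow_natCast]
  have key : p₁ * r₁ ^ i + p₂ * r₂ ^ i =
      Real.exp ((Real.log p₁ + Real.log p₂) / 2 + (Real.log r₁ + Real.log r₂) / 2 * i) * 2 *
      Real.cosh ((Real.log r₂ - Real.log r₁) / 2 * i - (Real.log p₁ - Real.log p₂) / 2) := by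
    rw [e p₁ r₁ hp₁ hr₁, e p₂ r₂ hp₂ hr₂, Real.cosh_eq, mul_assoc, mul_div_cancel₀ _ two_ne_zero,
      mul_add, ← Real.exp_add, ← Real.exp_add, add_comm]
    congr 2 <;> ring
  rw [key, Real.log_mul (by positivity) (Real.cosh_pos _).ne', Real.log_mul (by positivity)
    two_ne_zero, Real.log_exp]
  ring

theorem tilt_mul {k y x : ℝ≥0} (hk : 0 < k) (α : ℝ) :
    tilt (-α / k) (k * y) (k * x) = Real.exp (-α * |(x : ℝ) - y|) := by
  have hk' : (0 : ℝ) < k := hk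
  rw [tilt, ← mul_sub, abs_mul, abs_of_pos hk']
  congr 1
  field_simp

/-- A saddle point of the rescaled problem closes the duality gap. -/
theorem innerObjective_le_dualObjective {k y x₁ x₂ : ℝ≥0} (hk : 0 < k) (hy : 0 < y) (h1 : x₁ < y)
    (h2 : y < x₂) {h α u w : ℝ} (hh : 0 < h) (hα : α < 0) (hu : 0 < u) (hu1 : u < 1) (hw0 : 0 < w)
    (hw1 : w < 1)
    (hsaddle : ∀ z : ℝ, 0 ≤ z → gain (-α / k) (k * y)
      (wt u (-α / k) (k * y) (w, (k * x₁ : ℝ), (k * x₂ : ℝ))) z ≤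
      affinity u (-α / k) (k * y) (w, (k * x₁ : ℝ), (k * x₂ : ℝ))) :
    ∃ q : ℝ, 0 < q ∧ q < 1 ∧
      innerObjective k y h α u (fun i => Real.log (pairRatio k y x₁ x₂ q i)) < ⊤ ∧
      innerObjective k y h α u (fun i => Real.log (pairRatio k y x₁ x₂ q i)) ≤
        dualObjective k y h α u (pairWeight x₁ x₂ q) := by
  have hk' : (0 : ℝ) < k := hk
  have hy' : (0 : ℝ) < y := hy
  set b : ℝ := -α / k with hb_def
  set τ : ℝ := k * y with hτ_def
  set c : ℝ × ℝ × ℝ := (w, (k * x₁ : ℝ), (k * x₂ : ℝ)) with hc_def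
  have hb : 0 < b := div_pos (by linarith) hk'
  have hτ : 0 < τ := mul_pos hk' hy'
  have hc : c ∈ configs τ := ⟨hw0, hw1.le, by positivity,
    mul_le_mul_of_nonneg_left (NNReal.coe_le_coe.2 h1.le) hk'.le,
    mul_le_mul_of_nonneg_left (NNReal.coe_le_coe.2 h2.le) hk'.le⟩
  have hw1' : 0 < 1 - w := by linarith
  set E₁ := tilt b τ (k * x₁) with hE₁
  set E₂ := tilt b τ (k * x₂) with hE₂
  have p1 : 0 < E₁ := tilt_pos _ _ _
  have p2 : 0 < E₂ := tilt_pos _ _ _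
  -- A cost `c` at `x` corresponds to the mass `c` times the tilt at `x`; division by `Z` makes the
  -- masses sum to 1. The powers of `Z` cancel in both objectives, leaving `h log N`.
  set Z := (1 - w) * E₁ + w * E₂ with hZ
  have hZpos : 0 < Z := by positivity
  set q := (1 - w) * E₁ / Z with hq
  have hq' : 1 - q = w * E₂ / Z := by rw [hq]; field_simp; rw [hZ]; ring
  have hq0 : 0 < q := by positivity
  have hq1 : 0 < 1 - q := by rw [hq']; positivity
  set N := affinity u b τ c
  have hN : HasSum (fun i => mix b τ c i ^ (1 - u) * poiReal τ i) N :=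
    (hasSum_affinity hu hb hτ hc).1
  have mpos := mix_pos hb hτ hc
  have hNpos : 0 < N := by
    rw [← hN.tsum_eq]
    exact hN.summable.tsum_pos
      (fun i => (mul_pos (Real.rpow_pos_of_pos (mpos i) _) (poiReal_pos hτ i)).le) 0
      (mul_pos (Real.rpow_pos_of_pos (mpos 0) _) (poiReal_pos hτ 0))
  have hlike : ∀ (x : ℝ≥0) (i : ℕ), likeRatio τ (k * x) i =
      Real.exp (k * ((y : ℝ) - x)) * ((x : ℝ) / y) ^ i := fun x i => by
    rw [likeRatio, hτ_def, ← mul_sub, mul_div_mul_left _ _ hk'.ne']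
  have hratio : ∀ i, pairRatio k y x₁ x₂ q i = mix b τ c i / Z := fun i => by
    rw [pairRatio, hq', hq, mix]
    simp only [hc_def, hlike, ← hE₁, ← hE₂]
    field_simp
  have hpoi : ∀ (x : ℝ≥0) (i : ℕ), poi (k * x) i =
      ENNReal.ofReal (Real.exp (-(k * x)) * ((k * x : ℝ) ^ i / (i.factorial : ℝ))) := fun x i => by
    rw [poi_eq]; push_cast; rfl
  have hpoiy : ∀ i, poi (k * y) i = ENNReal.ofReal (poiReal τ i) := hpoi y
  set κ : ℕ → ℝ := fun i => Real.log (pairRatio k y x₁ x₂ q i) with hκ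
  have hexp : ∀ (v : ℝ) (i : ℕ), Real.exp (v * κ i) = mix b τ c i ^ v / Z ^ v := fun v i => by
    simp only [hκ]
    rw [hratio, mul_comm, ← Real.rpow_def_of_pos (div_pos (mpos i) hZpos),
      Real.div_rpow (mpos i).le hZpos.le]
  have hZu := Real.rpow_pos_of_pos hZpos u
  have hZv := Real.rpow_pos_of_pos hZpos (1 - u)
  have sumN : ∑' i, ENNReal.ofReal (mix b τ c i ^ (1 - u) / Z ^ (1 - u)) * poi (k * y) i =
      ENNReal.ofReal (N / Z ^ (1 - u)) := by
    have hs := hN.div_const (Z ^ (1 - u))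
    rw [← hs.tsum_eq, ENNReal.ofReal_tsum_of_nonneg _ hs.summable]
    · refine tsum_congr fun i => ?_
      rw [hpoiy, ← ENNReal.ofReal_mul (by have := mpos i; positivity), div_mul_eq_mul_div]
    · intro i
      have := mpos i
      have := poiReal_pos hτ i
      positivity
  have hnull : nullSum k y u κ = ENNReal.ofReal (N / Z ^ (1 - u)) := by
    rw [nullSum, ← sumN]
    simp only [hexp]
  obtain ⟨C, hC⟩ := exists_abs_wt_le (u := u) hu hb hτ hc
  have halt : ∀ x, altSum k y α u κ x ≤ ENNReal.ofReal (N * Z ^ u) := fun x => by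
    have hs := ((summable_egf hC (k * x)).hasSum.mul_left (Real.exp (-(k * x)))).mul_left (Z ^ u)
    have e : ∑' i, ENNReal.ofReal (Real.exp (-u * κ i)) * poi (k * x) i =
        ENNReal.ofReal (Z ^ u * (Real.exp (-(k * x)) * egf (wt u b τ c) (k * x))) := by
      rw [egf, ← hs.tsum_eq, ENNReal.ofReal_tsum_of_nonneg _ hs.summable]
      · refine tsum_congr fun i => ?_
        rw [hexp, hpoi, ← ENNReal.ofReal_mul (by have := mpos i; positivity), wt,
          Real.rpow_neg hZpos.le, div_inv_eq_mul]
        congr 1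
        ring
      · intro i
        have := wt_pos (u := u) hb hτ hc i
        positivity
    rw [altSum, e, ← ENNReal.ofReal_mul (by positivity), ← tilt_mul hk]
    refine ENNReal.ofReal_le_ofReal ?_
    have := mul_le_mul_of_nonneg_left (hsaddle (k * x) (by positivity)) hZu.le
    rw [gain] at this
    linarith
  have hprimal : innerObjective k y h α u κ ≤ h * ENNReal.log (ENNReal.ofReal N) := by
    rw [innerObjective_eq k y hh, coe_mul_log, coe_mul_log]
    refine ENNReal.log_le_log (ENNReal.rpow_le_rpow ?_ hh.le)
    refine (mul_le_mul_right (ENNReal.rpow_le_rpow (iSup_le halt) (by linarith)) _).trans_eq ?_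
    rw [hnull, ENNReal.ofReal_rpow_of_pos (by positivity), ENNReal.ofReal_rpow_of_pos
      (by positivity), ← ENNReal.ofReal_mul (by positivity)]
    congr 1
    rw [Real.div_rpow hNpos.le hZv.le, Real.mul_rpow hNpos.le hZu.le, ← Real.rpow_mul hZpos.le,
      ← Real.rpow_mul hZpos.le, mul_comm (1 - u) u, div_mul_eq_mul_div,
      ← mul_assoc, mul_div_assoc, div_self (Real.rpow_pos_of_pos hZpos _).ne', mul_one,
      ← Real.rpow_add hNpos]
    simp
  refine ⟨q, hq0, by linarith, hprimal.trans_lt ?_, hprimal.trans_eq ?_⟩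
  · rw [coe_mul_log, ENNReal.log_lt_top_iff]
    exact ENNReal.rpow_lt_top_of_nonneg hh.le ENNReal.ofReal_ne_top
  · have hden : ∑' x : ℝ≥0, (pairWeight x₁ x₂ q x : ℝ≥0∞) *
        ENNReal.ofReal (Real.exp (α * |(x : ℝ) - y|)) = ENNReal.ofReal Z⁻¹ := by
      have hinv : ∀ x : ℝ≥0, Real.exp (α * |(x : ℝ) - y|) = (tilt b τ (k * x))⁻¹ := fun x => by
        rw [hb_def, hτ_def, tilt_mul hk, ← Real.exp_neg]
        congr 1
        ring
      rw [tsum_pairWeight (h1.trans h2).ne, hinv, hinv, ← ENNReal.ofReal_mul hq0.le,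
        ← ENNReal.ofReal_mul hq1.le, ← ENNReal.ofReal_add (by positivity) (by positivity), hq', hq]
      congr 1
      rw [← hE₁, ← hE₂]
      field_simp
      ring
    have hnum : ∀ i, (∑' x : ℝ≥0, (pairWeight x₁ x₂ q x : ℝ≥0∞) * poi (k * x) i) ^ (1 - u) *
        poi (k * y) i ^ u =
        ENNReal.ofReal (mix b τ c i ^ (1 - u) / Z ^ (1 - u)) * poi (k * y) i := fun i => by
      have hp := poi_pos (mul_pos hk hy) i
      have hpt : poi (k * y) i ≠ ⊤ := by rw [hpoiy]; exact ENNReal.ofReal_ne_top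
      have e := tsum_pairWeight_ratio hk hy h1 h2 hq0 (by linarith) i
      have e2 : ∑' x : ℝ≥0, (pairWeight x₁ x₂ q x : ℝ≥0∞) * poi (k * x) i =
          ENNReal.ofReal (mix b τ c i / Z) * poi (k * y) i := by
        rw [← hratio, ← e, ← ENNReal.tsum_mul_right]
        refine tsum_congr fun x => ?_
        rw [mul_assoc, ENNReal.div_mul_cancel hp.ne' hpt]
      rw [e2, ENNReal.mul_rpow_of_nonneg _ _ (by linarith : 0 ≤ 1 - u), mul_assoc,
        ← ENNReal.rpow_add _ _ hp.ne' hpt, ENNReal.ofReal_rpow_of_pos (div_pos (mpos i) hZpos),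
        Real.div_rpow (mpos i).le hZpos.le]
      simp
    rw [dualObjective, hden, tsum_congr hnum, sumN, ENNReal.ofReal_rpow_of_pos (by positivity),
      ← ENNReal.ofReal_div_of_pos (by positivity), Real.inv_rpow hZpos.le]
    congr 3
    field_simp

end TwoPoint

/-! ### Conclusion -/

theorem mainTheorem3 (k y : ℝ≥0) (hk : 0 < k) (hy : 0 < y) (h : ℝ) (hh : 0 < h)
    (α u : ℝ) (hα : α < 0) (hu0 : 0 < u) (hu1 : u < 1) :
    ∃ (κ : ℕ → ℝ) (a : ℝ≥0 → ℝ≥0) (x₁ x₂ : ℝ≥0) (q : ℝ),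
      IsMinOn (TwoPoint.innerObjective k y h α u) Set.univ κ ∧
      TwoPoint.HasClosedForm k y a κ ∧
      x₁ < y ∧ y < x₂ ∧ {x | a x ≠ 0} = {x₁, x₂} ∧
      0 < q ∧ q < 1 ∧ (a x₁ : ℝ) = q ∧ (a x₂ : ℝ) = 1 - q ∧
      (∀ b : ℝ≥0 → ℝ≥0, TwoPoint.HasClosedForm k y b κ → b = a) ∧
      (∀ i : ℕ, κ i = Real.log (q * Real.exp (k * (y - x₁)) * ((x₁ : ℝ) / y) ^ i +
        (1 - q) * Real.exp (k * (y - x₂)) * ((x₂ : ℝ) / y) ^ i)) ∧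
      (0 < x₁ → ∃ A B C s : ℝ, 0 < C ∧
        ∀ i : ℕ, κ i = A + B * i + Real.log (Real.cosh (C * (i - s)))) ∧
      (-(k : ℝ) < α →
        TwoPoint.innerObjective k y h α u κ < ⊤ ∧
        TwoPoint.innerObjective k y h α u κ = TwoPoint.dualObjective k y h α u a ∧
        IsMaxOn (TwoPoint.dualObjective k y h α u) Set.univ a) := by

  suffices H : ∃ (x₁ x₂ : ℝ≥0) (q : ℝ), x₁ < y ∧ y < x₂ ∧ 0 < q ∧ q < 1 ∧
      (-(k : ℝ) < α →
        TwoPoint.innerObjective k y h α u (fun i => Real.log (TwoPoint.pairRatio k y x₁ x₂ q i)) <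
          ⊤ ∧
        TwoPoint.innerObjective k y h α u (fun i => Real.log (TwoPoint.pairRatio k y x₁ x₂ q i)) ≤
          TwoPoint.dualObjective k y h α u (TwoPoint.pairWeight x₁ x₂ q)) by
    obtain ⟨x₁, x₂, q, h1, h2, hq0, hq1, hopt⟩ := H
    have hne : x₁ ≠ x₂ := (h1.trans h2).ne
    have hq1' : 0 < 1 - q := by linarith
    have hM := fun i => TwoPoint.pairRatio_pos (k := k) (x₁ := x₁) hy h2 hq0 hq1 i
    have weak := TwoPoint.dualObjective_le_innerObjective k y hh α hu0 hu1
    have a1 : (TwoPoint.pairWeight x₁ x₂ q x₁ : ℝ) = q := by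
      simp [TwoPoint.pairWeight, hq0.le]
    have a2 : (TwoPoint.pairWeight x₁ x₂ q x₂ : ℝ) = 1 - q := by
      simp [TwoPoint.pairWeight, hne.symm, hq1.le]
    refine ⟨fun i => Real.log (TwoPoint.pairRatio k y x₁ x₂ q i), TwoPoint.pairWeight x₁ x₂ q,
      x₁, x₂, q, fun κ _ => ?_, (TwoPoint.hasClosedForm_iff hM).2
      (TwoPoint.tsum_pairWeight_ratio hk hy h1 h2 hq0 hq1), h1, h2, ?_, hq0, hq1, a1, a2,
      fun b hb => TwoPoint.eq_pairWeight hk hy h1 h2 hq0 hq1 ((TwoPoint.hasClosedForm_iff hM).1 hb),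
      fun i => rfl, fun hx => ?_, fun hα' => ?_⟩
    · rcases lt_or_ge (-(k : ℝ)) α with hα' | hα'
      · exact (hopt hα').2.trans (weak _ κ)
      · exact le_top.trans_eq (TwoPoint.innerObjective_eq_top hk hy hh hu0 hu1 hα' κ).symm
    · ext x
      by_cases g1 : x = x₁
      · simp [TwoPoint.pairWeight, g1, hq0]
      · by_cases g2 : x = x₂
        · simp [TwoPoint.pairWeight, g2, hne.symm, hq1]
        · simp [TwoPoint.pairWeight, g1, g2]
    · have hy' : (0 : ℝ) < y := hy
      exact TwoPoint.exists_log_cosh (mul_pos hq0 (Real.exp_pos _)) (mul_pos hq1' (Real.exp_pos _))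
        (div_pos (NNReal.coe_pos.2 hx) hy')
        (div_lt_div_of_pos_right (NNReal.coe_lt_coe.2 (h1.trans h2)) hy')
    · obtain ⟨hfin, hle⟩ := hopt hα'
      exact ⟨hfin, hle.antisymm (weak _ _), fun a _ => (weak a _).trans hle⟩
  have hk' : (0 : ℝ) < k := hk
  have hy' : (0 : ℝ) < y := hy
  rcases lt_or_ge (-(k : ℝ)) α with hα' | hα'
  · obtain ⟨w, s, t, hw0, hw1, hs0, hs, ht, hsaddle⟩ := TwoPoint.exists_saddlePoint
      (b := -α / k) (τ := k * y) hu0 hu1 (div_pos (by linarith) hk')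
      ((div_lt_one hk').2 (by linarith)) (mul_pos hk' hy')
    have ht0 : 0 ≤ t := (mul_pos hk' hy').le.trans ht.le
    have es : (k : ℝ) * (s.toNNReal / k : ℝ≥0) = s := by
      rw [NNReal.coe_div, Real.coe_toNNReal _ hs0, mul_div_cancel₀ _ hk'.ne']
    have et : (k : ℝ) * (t.toNNReal / k : ℝ≥0) = t := by
      rw [NNReal.coe_div, Real.coe_toNNReal _ ht0, mul_div_cancel₀ _ hk'.ne']
    have h1 : s.toNNReal / k < y := NNReal.coe_lt_coe.1
      (lt_of_mul_lt_mul_left (es.trans_lt hs) hk'.le)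
    have h2 : y < t.toNNReal / k := NNReal.coe_lt_coe.1
      (lt_of_mul_lt_mul_left (ht.trans_eq et.symm) hk'.le)
    obtain ⟨q, hq0, hq1, H⟩ := TwoPoint.innerObjective_le_dualObjective hk hy h1 h2 hh hα hu0 hu1
      hw0 hw1 (by rw [es, et]; exact hsaddle)
    exact ⟨_, _, q, h1, h2, hq0, hq1, fun _ => H⟩
  -- The primal is identically infinite here, so this choice is arbitrary.
  · refine ⟨y / 2, y * 2, 1 / 2, NNReal.half_lt_self hy.ne', ?_, by norm_num, by norm_num,
      fun h => absurd h hα'.not_gt⟩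
    exact lt_mul_of_one_lt_right hy one_lt_two
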